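/- Let $n\ge 0$ be an integer. Let $Y$ be a metric space of covering dimension at most $n$ that is an absolute neighborhood extensor in dimension $n$ (an $ANE(n)$-space): every map (= continuous map) into $Y$ from a closed subset $A$ of an at most $n$-dimensional metric space extends over an open neighborhood of $A$. Let $X$ be a topological space and let $f\colon X\to Y$ be a map. Assume that $f$ is a $UV^{n-1}$-map, i.e. that for each open cover $\mathcal U$ of $Y$ the following holds: the union of those members of $\mathcal U$ that meet $f(X)$ is $Y$, and there exists an open cover $\mathcal W$ of $Y$ such that for each $W\in\mathcal W$ there exists $U\in\mathcal U$ with $f^{-1}(W)\subset f^{-1}(U)$ for which the inclusion $f^{-1}(W)\subset f^{-1}(U)$ induces trivial maps $\pi_k(f^{-1}(W),x)\to\pi_k(f^{-1}(U),x)$ for all $0\le k<n$ and all base points $x\in f^{-1}(W)$. Then $f$ is a fine $n$-homotopy equivalence, i.e. for each open cover $\mathcal U$ of $Y$ there exists a map $g\colon Y\to X$ such that $f\circ g$ is $\mathcal U$-$n$-homotopic to $\mathrm{id}_Y$ and $g\circ f$ is $f^{-1}(\mathcal U)$-$n$-homotopic to $\mathrm{id}_X$, where $f^{-1}(\mathcal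 U)=\{f^{-1}(U)\colon U\in\mathcal U\}$. Here, for an open cover $\mathcal V$ of a space $Z'$, maps $a,b\colon Z\to Z'$ are called $\mathcal V$-$n$-homotopic if for every map $\Phi$ into $Z$ from a polyhedron (the geometric realization of a simplicial complex, with the weak topology) of dimension less than $n$, the compositions $a\circ\Phi$ and $b\circ\Phi$ are homotopic by a homotopy each of whose paths lies in some member of $\mathcal V$. -/

import Mathlib

open scoped unitInterval Topology

universe u v w

namespace FineHomotopy

/-! ### Open covers and covering dimension -/

/-- `𝒰` is a family of open subsets of `Y` whose union is `Y`. -/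
def IsOpenCovering {Y : Type u} [TopologicalSpace Y] (𝒰 : Set (Set Y)) : Prop :=
  (∀ U ∈ 𝒰, IsOpen U) ∧ ⋃₀ 𝒰 = Set.univ

/-- The star of a set `A` in a family `𝒰`: the union of the members of `𝒰` that meet `A`. -/
def starOf {Y : Type u} (A : Set Y) (𝒰 : Set (Set Y)) : Set Y :=
  ⋃₀ {U ∈ 𝒰 | (U ∩ A).Nonempty}

/-- The family `f⁻¹(𝒰)` of the preimages of the members of `𝒰`. -/
def preimageFamily {X : Type u} {Y : Type v} (f : X → Y) (𝒰 : Set (Set Y)) : Set (Set X) :=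
  (fun U => f ⁻¹' U) '' 𝒰

/-- The covering dimension of `Y` is at most `n`: every open cover has an open refinement such
that every point lies in at most `n + 1` of its members. -/
def DimLE (n : ℕ) (Y : Type u) [TopologicalSpace Y] : Prop :=
  ∀ 𝒰 : Set (Set Y), IsOpenCovering 𝒰 →
    ∃ 𝒱 : Set (Set Y), IsOpenCovering 𝒱 ∧ (∀ V ∈ 𝒱, ∃ U ∈ 𝒰, V ⊆ U) ∧
      ∀ y : Y, {V ∈ 𝒱 | y ∈ V}.encard ≤ n + 1

/-! ### Absolute neighborhood extensors in dimension `n` -/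

/-- Every map into `Y` from a closed subset `A` of an at most `n`-dimensional metric space `B`
extends over an open neighborhood `O` of `A` in `B`. -/
def IsANE (n : ℕ) (Y : Type u) [TopologicalSpace Y] : Prop :=
  ∀ (B : Type u) [MetricSpace B], DimLE n B → ∀ A : Set B, IsClosed A → ∀ φ : C(A, Y),
    ∃ O : Set B, IsOpen O ∧ ∃ hAO : A ⊆ O, ∃ φ' : C(O, Y),
      ∀ a : A, φ' (Set.inclusion hAO a) = φ a

/-! ### Homotopy groups and `UV`-maps -/

/-- The map `π_k(X, x) → π_k(Y, g x)` induced by a continuous map `g`.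
(For `k = 0` this is the induced map of sets of path components.) -/
def homotopyGroupMap (k : ℕ) {X : Type u} {Y : Type v} [TopologicalSpace X] [TopologicalSpace Y]
    (g : C(X, Y)) (x : X) :
    HomotopyGroup (Fin k) X x → HomotopyGroup (Fin k) Y (g x) :=
  Quotient.map
    (fun γ => (⟨g.comp γ.1, fun y hy => congrArg g (γ.2 y hy)⟩ : GenLoop (Fin k) Y (g x)))
    (fun _ _ h => h.map fun H => ContinuousMap.HomotopyRel.compContinuousMap H g)

/-- `g` induces trivial homomorphisms on homotopy groups of dimensions less than `n`, for every
choice of the base point: every class is sent to the class of the constant loop. -/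
def TrivialOnHomotopyBelow (n : ℕ) {X : Type u} {Y : Type v} [TopologicalSpace X]
    [TopologicalSpace Y] (g : C(X, Y)) : Prop :=
  ∀ k < n, ∀ x : X, ∀ a : HomotopyGroup (Fin k) X x,
    homotopyGroupMap k g x a = Quotient.mk _ GenLoop.const

/-- The condition `(uv)` relative to the open cover `𝒰`. -/
def UVFor (n : ℕ) {X : Type u} {Y : Type v} [TopologicalSpace X] [TopologicalSpace Y]
    (f : C(X, Y)) (𝒰 : Set (Set Y)) : Prop :=
  starOf (Set.range f) 𝒰 = Set.univ ∧
    ∃ 𝒲 : Set (Set Y), IsOpenCovering 𝒲 ∧ ∀ W ∈ 𝒲, ∃ U ∈ 𝒰, ∃ h : f ⁻¹' W ⊆ f ⁻¹' U,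
      TrivialOnHomotopyBelow n
        (⟨Set.inclusion h, continuous_inclusion h⟩ : C(f ⁻¹' W, f ⁻¹' U))

/-- `f` is a `UV^{n-1}`-map. -/
def IsUVMap (n : ℕ) {X : Type u} {Y : Type v} [TopologicalSpace X] [TopologicalSpace Y]
    (f : C(X, Y)) : Prop :=
  ∀ 𝒰 : Set (Set Y), IsOpenCovering 𝒰 → UVFor n f 𝒰

/-! ### Polyhedra -/

/-- The closed geometric simplex spanned by a finite set `s` of vertices, in barycentric
coordinates, as a subspace of `V → ℝ`. -/
def closedSimplex {V : Type w} (s : Finset V) : Set (V → ℝ) :=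
  {x | (∀ v, 0 ≤ x v) ∧ (∀ v, v ∉ s → x v = 0) ∧ ∑ v ∈ s, x v = 1}

/-- The polyhedron `|K|` of a simplicial complex `K` (not assumed finite or locally finite). -/
def Polyhedron {V : Type w} (K : PreAbstractSimplicialComplex V) : Type w :=
  {x : V → ℝ // ∃ s ∈ K.faces, x ∈ closedSimplex s}

/-- The inclusion of a closed simplex of `K` into `|K|`. -/
def Polyhedron.incl {V : Type w} (K : PreAbstractSimplicialComplex V) (s : K.faces)
    (x : closedSimplex (s : Finset V)) : Polyhedron K :=
  ⟨x, s, s.2, x.2⟩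

/-- The weak (Whitehead) topology of a polyhedron: a set is open if and only if its trace on every
closed simplex is open. -/
instance Polyhedron.instTopologicalSpace {V : Type w} (K : PreAbstractSimplicialComplex V) :
    TopologicalSpace (Polyhedron K) :=
  ⨆ s : K.faces, TopologicalSpace.coinduced (Polyhedron.incl K s) inferInstance

/-- `K` has dimension less than `n`: each of its simplexes has at most `n` vertices. -/
def ComplexDimLT {V : Type w} (K : PreAbstractSimplicialComplex V) (n : ℕ) : Prop :=
  ∀ s ∈ K.faces, s.card ≤ n

/-! ### `n`-homotopies and fine `n`-homotopy equivalences -/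

/-- `f` and `g` are homotopic by a homotopy each of whose paths lies in a member of `𝒰`. -/
def HomotopicWithin {X : Type u} {Y : Type v} [TopologicalSpace X] [TopologicalSpace Y]
    (𝒰 : Set (Set Y)) (f g : C(X, Y)) : Prop :=
  ∃ H : ContinuousMap.Homotopy f g, ∀ x : X, ∃ U ∈ 𝒰, ∀ t : I, H (t, x) ∈ U

/-- `f` and `g` are `𝒰`-`n`-homotopic: for every map `Φ` into `X` from a polyhedron of dimension
less than `n`, the maps `f ∘ Φ` and `g ∘ Φ` are homotopic by a homotopy whose paths refine `𝒰`.
The universe `w` is that of the vertices of the polyhedra. -/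
def NHomotopic (n : ℕ) {X : Type u} {Y : Type v} [TopologicalSpace X] [TopologicalSpace Y]
    (𝒰 : Set (Set Y)) (f g : C(X, Y)) : Prop :=
  ∀ (V : Type w) (K : PreAbstractSimplicialComplex V), ComplexDimLT K n →
    ∀ Φ : C(Polyhedron K, X), HomotopicWithin 𝒰 (f.comp Φ) (g.comp Φ)

/-- The condition `(fne)` relative to the open cover `𝒰`. -/
def FNEFor (n : ℕ) {X : Type u} {Y : Type v} [TopologicalSpace X] [TopologicalSpace Y]
    (f : C(X, Y)) (𝒰 : Set (Set Y)) : Prop :=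
  ∃ g : C(Y, X), NHomotopic.{v, v, w} n 𝒰 (f.comp g) (ContinuousMap.id Y) ∧
    NHomotopic.{u, u, w} n (preimageFamily f 𝒰) (g.comp f) (ContinuousMap.id X)

/-- `f` is a fine `n`-homotopy equivalence. -/
def IsFineNHomotopyEquiv (n : ℕ) {X : Type u} {Y : Type v} [TopologicalSpace X]
    [TopologicalSpace Y] (f : C(X, Y)) : Prop :=
  ∀ 𝒰 : Set (Set Y), IsOpenCovering 𝒰 → FNEFor.{u, v, w} n f 𝒰

end FineHomotopy

/-!
Call `f` locally extending if small preimages `f⁻¹(W)` absorb cubes: every map of `∂I^(k+1)`,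
`k < n`, into `f⁻¹(W)` extends over the cube within a slightly larger `f⁻¹(U)`. A `UV^(n-1)`-map
is locally extending by the definition of the homotopy groups, since the concentric spheres of a
cube are quotients of a cube one dimension lower. The identity of `Y` is locally extending by the
`ANE(n)` property applied to the product of a cube and a convergent sequence: otherwise, boundary
maps that shrink to a point without small extensions would fit into one map with no neighborhood
extension.

Iterating the property `n` times gives carriers along which maps can be constructed cube by cube.
Two applications yield the theorem. First, the nerve of a cover of `Y` of order
`n + 1`, with its simplexes normalized so that the greatest coordinate is `1`, is a union of unit
cubes, and building a map on it cube by cube gives `g : Y → X` with `f ∘ g` close to the identity.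
Second, two maps of a polyhedron of dimension less than `n` whose compositions with `f` are close
are joined by a homotopy that is built over the cubes of the polyhedron.
-/

namespace FineHomotopy

open Set

/-! ### Open covers -/

section Covers

variable {Y : Type u}

theorem starOf_mono {A B : Set Y} (h : A ⊆ B) (𝒰 : Set (Set Y)) : starOf A 𝒰 ⊆ starOf B 𝒰 :=
  sUnion_subset_sUnion fun _ hU => ⟨hU.1, hU.2.mono (inter_subset_inter_right _ h)⟩

theorem subset_starOf {A U : Set Y} {𝒰 : Set (Set Y)} (hU : U ∈ 𝒰) (h : (U ∩ A).Nonempty) :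
    U ⊆ starOf A 𝒰 :=
  subset_sUnion_of_mem ⟨hU, h⟩

/-- The family `𝒱` refines the family `𝒰`: each member of `𝒱` is contained in one of `𝒰`. -/
def Refines (𝒱 𝒰 : Set (Set Y)) : Prop := ∀ V ∈ 𝒱, ∃ U ∈ 𝒰, V ⊆ U

theorem inter_refines_left (𝒰 𝒱 : Set (Set Y)) : Refines (image2 (· ∩ ·) 𝒰 𝒱) 𝒰 := by
  rintro _ ⟨U, hU, V, -, rfl⟩
  exact ⟨U, hU, inter_subset_left⟩

theorem inter_refines_right (𝒰 𝒱 : Set (Set Y)) : Refines (image2 (· ∩ ·) 𝒰 𝒱) 𝒱 := by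
  rintro _ ⟨U, -, V, hV, rfl⟩
  exact ⟨V, hV, inter_subset_right⟩

theorem preimageFamily_id (𝒰 : Set (Set Y)) : preimageFamily id 𝒰 = 𝒰 := by
  simp [preimageFamily]

variable [TopologicalSpace Y] {𝒰 𝒱 : Set (Set Y)}

theorem IsOpenCovering.exists_mem (h𝒰 : IsOpenCovering 𝒰) (y : Y) : ∃ U ∈ 𝒰, y ∈ U :=
  sUnion_eq_univ_iff.1 h𝒰.2 y

theorem isOpenCovering_range {ι : Sort*} {U : ι → Set Y} (hU : ∀ i, IsOpen (U i))
    (h : ∀ y, ∃ i, y ∈ U i) : IsOpenCovering (range U) :=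
  ⟨forall_mem_range.2 hU, sUnion_eq_univ_iff.2 fun y => exists_range_iff.2 (h y)⟩

theorem IsOpenCovering.inter (h𝒰 : IsOpenCovering 𝒰) (h𝒱 : IsOpenCovering 𝒱) :
    IsOpenCovering (image2 (· ∩ ·) 𝒰 𝒱) := by
  refine ⟨?_, sUnion_eq_univ_iff.2 fun y => ?_⟩
  · rintro _ ⟨U, hU, V, hV, rfl⟩
    exact (h𝒰.1 U hU).inter (h𝒱.1 V hV)
  · obtain ⟨U, hU, hyU⟩ := h𝒰.exists_mem y
    obtain ⟨V, hV, hyV⟩ := h𝒱.exists_mem y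
    exact ⟨_, mem_image2_of_mem hU hV, hyU, hyV⟩

end Covers

theorem IsOpenCovering.exists_star_refinement {Y : Type u} [PseudoMetricSpace Y]
    {𝒰 : Set (Set Y)} (h𝒰 : IsOpenCovering 𝒰) :
    ∃ 𝒱 : Set (Set Y), IsOpenCovering 𝒱 ∧ ∀ V ∈ 𝒱, ∃ U ∈ 𝒰, starOf V 𝒱 ⊆ U := by
  have hball : ∀ y, ∃ r, 0 < r ∧ r ≤ 1 ∧ ∃ U ∈ 𝒰, Metric.ball y r ⊆ U := by
    intro y
    obtain ⟨U, hU, hyU⟩ := h𝒰.exists_mem y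
    obtain ⟨r, hr, hrU⟩ := Metric.isOpen_iff.1 (h𝒰.1 U hU) y hyU
    exact ⟨min r 1, lt_min hr one_pos, min_le_right _ _, U, hU,
      (Metric.ball_subset_ball (min_le_left _ _)).trans hrU⟩
  choose r hr hr_le U hU hrU using hball
  let B : Y → Set Y := fun y => Metric.ball y (r y / 10)
  refine ⟨range B, isOpenCovering_range (fun _ => Metric.isOpen_ball)
    fun y => ⟨y, Metric.mem_ball_self (by linarith [hr y])⟩, ?_⟩
  rintro _ ⟨y, rfl⟩
  -- The star of `B y` is swallowed by the ball around the centre `z` of one of the balls meeting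
  -- `B y` whose radius is more than half the supremum of the radii of these balls.
  let J : Set Y := {z | (B z ∩ B y).Nonempty}
  have hyJ : y ∈ J := ⟨y, by simp [B, hr y]⟩
  have hle : ∀ z ∈ J, r z ≤ sSup (r '' J) := fun z hz =>
    le_csSup ⟨1, forall_mem_image.2 fun z _ => hr_le z⟩ (mem_image_of_mem r hz)
  obtain ⟨_, ⟨z, hz, rfl⟩, hsz⟩ := exists_lt_of_lt_csSup (nonempty_of_mem (mem_image_of_mem r hyJ))
    (half_lt_self ((hr y).trans_le (hle y hyJ)))
  refine ⟨U z, hU z, ?_⟩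
  rintro a ⟨_, ⟨⟨z', rfl⟩, hz'⟩, ha⟩
  apply hrU z
  obtain ⟨b, hbz, hby⟩ := hz
  obtain ⟨b', hbz', hby'⟩ := id hz'
  simp only [B, Metric.mem_ball] at ha hbz hby hbz' hby' ⊢
  calc dist a z ≤ dist a z' + dist b' z' + dist b' y + dist b y + dist b z := by
        linarith [dist_triangle a z' z, dist_triangle_left z' z b', dist_triangle b' y z,
          dist_triangle_left y z b]
    _ < r z := by linarith [hle z' hz', hle y hyJ, hle z ⟨b, hbz, hby⟩]

theorem exists_seq_of_forall_exists {α : Type*} {p : α → Prop} {R : α → α → Prop}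
    (h : ∀ a, p a → ∃ b, p b ∧ R b a) (n : ℕ) {a : α} (ha : p a) :
    ∃ s : ℕ → α, s n = a ∧ (∀ i, p (s i)) ∧ ∀ i < n, R (s i) (s (i + 1)) := by
  choose! g hp hR using h
  have hpg : ∀ i, p (g^[i] a) := fun i => by
    induction i with
    | zero => exact ha
    | succ i ih => simpa only [Function.iterate_succ_apply'] using hp _ ih
  refine ⟨fun i => g^[n - i] a, by simp, fun i => hpg _, fun i hi => ?_⟩
  have hni : n - i = n - (i + 1) + 1 := by lia
  simpa only [hni, Function.iterate_succ_apply'] using hR _ (hpg (n - (i + 1)))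

/-! ### Integer unit boxes and skeletal induction -/

/-- A unit box with integer corners in `V → ℝ`, extended in finitely many directions. -/
structure Cell (V : Type w) where
  /-- The least corner of the box. -/
  base : V → ℤ
  /-- The directions in which the box is extended. -/
  dirs : Finset V

namespace Cell

variable {V : Type w} {c : Cell V} {x : V → ℝ}

/-- The dimension of a box. -/
abbrev dim (c : Cell V) : ℕ := c.dirs.card

/-- The set of points of a box. -/
def carrier (c : Cell V) : Set (V → ℝ) :=
  {x | ∀ v, (c.base v : ℝ) ≤ x v ∧ x v ≤ c.base v + 1 ∧ (v ∉ c.dirs → x v = c.base v)}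

/-- The combinatorial boundary of a box. -/
def bdry (c : Cell V) : Set (V → ℝ) :=
  {x ∈ c.carrier | ∃ v ∈ c.dirs, x v = c.base v ∨ x v = c.base v + 1}

open Classical in
/-- The smallest box that contains a given point, provided that some box contains it. -/
noncomputable def minCell (x : V → ℝ) : Cell V where
  base v := ⌊x v⌋
  dirs := if h : {v | x v ≠ ⌊x v⌋}.Finite then h.toFinset else ∅

theorem base_mem_carrier (c : Cell V) : (fun v => (c.base v : ℝ)) ∈ c.carrier :=
  fun _ => ⟨le_rfl, (lt_add_one _).le, fun _ => rfl⟩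

theorem setOf_ne_floor_subset (hx : x ∈ c.carrier) : {v | x v ≠ ⌊x v⌋} ⊆ c.dirs := by
  intro v hv
  by_contra h
  exact hv (by simp [(hx v).2.2 h])

theorem mem_dirs_minCell (hx : x ∈ c.carrier) {v : V} :
    v ∈ (minCell x).dirs ↔ x v ≠ ⌊x v⌋ := by
  simp [minCell, c.dirs.finite_toSet.subset (setOf_ne_floor_subset hx)]

theorem dirs_minCell_subset (hx : x ∈ c.carrier) : (minCell x).dirs ⊆ c.dirs :=
  fun _ hv => setOf_ne_floor_subset hx ((mem_dirs_minCell hx).1 hv)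

theorem mem_minCell (hx : x ∈ c.carrier) : x ∈ (minCell x).carrier := fun _ =>
  ⟨Int.floor_le _, (Int.lt_floor_add_one _).le, fun h => not_not.1 ((mem_dirs_minCell hx).not.1 h)⟩

theorem minCell_subset (hx : x ∈ c.carrier) : (minCell x).carrier ⊆ c.carrier := by
  intro z hz v
  obtain ⟨hxl, hxr, -⟩ := hx v
  by_cases hv : x v = ⌊x v⌋
  · have hzx : z v = x v := ((hz v).2.2 ((mem_dirs_minCell hx).not.2 (not_not.2 hv))).trans hv.symm
    exact hzx ▸ hx v
  · have hlt : x v < c.base v + 1 := hxr.lt_of_ne fun h => hv (by simp [h])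
    have hfloor : ⌊x v⌋ = c.base v := Int.floor_eq_iff.2 ⟨hxl, hlt⟩
    refine ⟨hfloor ▸ (hz v).1, hfloor ▸ (hz v).2.1, fun hd => ?_⟩
    exact absurd (setOf_ne_floor_subset hx hv) hd

theorem dim_minCell_lt (hx : x ∈ c.bdry) : (minCell x).dim < c.dim := by
  obtain ⟨hx, v, hv, h⟩ := hx
  refine Finset.card_lt_card ⟨dirs_minCell_subset hx, fun hs => ?_⟩
  apply (mem_dirs_minCell hx).1 (hs hv)
  rcases h with h | h <;> simp [h]

theorem minCell_eq (hx : x ∈ c.carrier) (hx' : x ∉ c.bdry) : minCell x = c := by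
  have hlt : ∀ v ∈ c.dirs, (c.base v : ℝ) < x v ∧ x v < c.base v + 1 := fun v hv =>
    ⟨(hx v).1.lt_of_ne fun h => hx' ⟨hx, v, hv, Or.inl h.symm⟩,
      (hx v).2.1.lt_of_ne fun h => hx' ⟨hx, v, hv, Or.inr h⟩⟩
  have hfloor : ∀ v, ⌊x v⌋ = c.base v := by
    intro v
    by_cases hv : v ∈ c.dirs
    · exact Int.floor_eq_iff.2 ⟨(hlt v hv).1.le, (hlt v hv).2⟩
    · rw [(hx v).2.2 hv, Int.floor_intCast]
  have hdirs : (minCell x).dirs = c.dirs := by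
    refine (dirs_minCell_subset hx).antisymm fun v hv => ?_
    rw [mem_dirs_minCell hx, hfloor]
    exact (hlt v hv).1.ne'
  have hbase : (minCell x).base = c.base := funext hfloor
  cases c
  simp_all only [minCell]

/-- A family of boxes that contains every box contained in one of its members. -/
def IsFaceClosed (𝒞 : Set (Cell V)) : Prop :=
  ∀ c ∈ 𝒞, ∀ c' : Cell V, c'.carrier ⊆ c.carrier → c' ∈ 𝒞

theorem exists_forall_of_extension {Z : Type*} [Nonempty Z] {𝒞 : Set (Cell V)} {n : ℕ}
    (hdim : ∀ c ∈ 𝒞, c.dim < n) (hface : IsFaceClosed 𝒞) (P : Cell V → ((V → ℝ) → Z) → Prop)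
    (hlocal : ∀ c ∈ 𝒞, ∀ h h', EqOn h h' c.carrier → P c h → P c h')
    (hext : ∀ c ∈ 𝒞, ∀ h, (∀ c' : Cell V, c'.carrier ⊆ c.carrier → c'.dim < c.dim → P c' h) →
      ∃ h', EqOn h h' c.bdry ∧ P c h') :
    ∃ h, ∀ c ∈ 𝒞, P c h := by
  classical
  suffices H : ∀ k, ∃ h, ∀ c ∈ 𝒞, c.dim < k → P c h by
    obtain ⟨h, hh⟩ := H n
    exact ⟨h, fun c hc => hh c hc (hdim c hc)⟩
  intro k
  induction k with
  | zero => exact ⟨Classical.arbitrary _, fun c _ h => absurd h (Nat.not_lt_zero _)⟩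
  | succ k ih =>
    obtain ⟨h, hh⟩ := ih
    have hex : ∀ c : Cell V, c ∈ 𝒞 ∧ c.dim = k → ∃ h', EqOn h h' c.bdry ∧ P c h' :=
      fun c ⟨hc, hk⟩ => hext c hc h fun c' hc' hlt => hh c' (hface c hc c' hc') (hk ▸ hlt)
    choose! E hEq hE using hex
    refine ⟨fun x => if minCell x ∈ 𝒞 ∧ (minCell x).dim = k then E (minCell x) x else h x,
      fun c hc hk => ?_⟩
    rcases Nat.lt_succ_iff_lt_or_eq.1 hk with hk | hk
    · refine hlocal c hc h _ (fun x hx => (if_neg ?_).symm) (hh c hc hk)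
      have := Finset.card_le_card (dirs_minCell_subset hx)
      exact fun h => (this.trans_lt hk).ne h.2
    · refine hlocal c hc (E c) _ (fun x hx => ?_) (hE c ⟨hc, hk⟩)
      by_cases hb : x ∈ c.bdry
      · rw [if_neg fun h => (hk ▸ dim_minCell_lt hb).ne h.2, hEq c ⟨hc, hk⟩ hb]
      · rw [minCell_eq hx hb, if_pos ⟨hc, hk⟩]

theorem isClosed_carrier (c : Cell V) : IsClosed c.carrier := by
  simp only [carrier, ofPred_forall, ofPred_and]
  refine isClosed_iInter fun v => (isClosed_le continuous_const (continuous_apply v)).inter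
    ((isClosed_le (continuous_apply v) continuous_const).inter ?_)
  exact isClosed_iInter fun _ => isClosed_eq (continuous_apply v) continuous_const

open Classical in
/-- The facet of a box obtained by fixing the coordinate `v` at its least (`ε = 0`) or greatest
(`ε = 1`) value. -/
noncomputable def facet (c : Cell V) (v : V) (ε : Fin 2) : Cell V where
  base z := if z = v then c.base v + (ε : ℕ) else c.base z
  dirs := c.dirs.erase v

theorem mem_facet {v : V} (hv : v ∈ c.dirs) {ε : Fin 2} :
    x ∈ (c.facet v ε).carrier ↔ x ∈ c.carrier ∧ x v = c.base v + (ε : ℕ) := by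
  constructor
  · intro h
    have hxv : x v = c.base v + (ε : ℕ) := by
      simpa [facet] using (h v).2.2 (by simp [facet])
    refine ⟨fun z => ?_, hxv⟩
    rcases eq_or_ne z v with rfl | hz
    · have hε : ((ε : ℕ) : ℝ) ≤ 1 := by exact_mod_cast Nat.lt_succ_iff.1 ε.2
      exact ⟨by simp [hxv], by linarith, fun h => absurd hv h⟩
    · simpa [facet, hz] using h z
  · rintro ⟨h, hxv⟩ z
    rcases eq_or_ne z v with rfl | hz
    · simp [facet, hxv]
    · simpa [facet, hz] using h z

theorem facet_subset {v : V} (hv : v ∈ c.dirs) (ε : Fin 2) : (c.facet v ε).carrier ⊆ c.carrier :=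
  fun _ hx => ((mem_facet hv).1 hx).1

theorem dim_facet_lt {v : V} (hv : v ∈ c.dirs) (ε : Fin 2) : (c.facet v ε).dim < c.dim := by
  classical
  exact Finset.card_erase_lt_of_mem hv

theorem bdry_eq_iUnion_facet (c : Cell V) :
    c.bdry = ⋃ p : c.dirs × Fin 2, (c.facet p.1 p.2).carrier := by
  ext x
  have hfacet : ∀ v ∈ c.dirs, (x ∈ (c.facet v 0).carrier ∨ x ∈ (c.facet v 1).carrier) ↔
      x ∈ c.carrier ∧ (x v = c.base v ∨ x v = c.base v + 1) := fun v hv => by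
    simp [mem_facet hv, and_or_left]
  simp only [mem_iUnion, Prod.exists, Subtype.exists, Fin.exists_fin_two]
  constructor
  · rintro ⟨hx, v, hv, h⟩
    exact ⟨v, hv, (hfacet v hv).2 ⟨hx, h⟩⟩
  · rintro ⟨v, hv, h⟩
    obtain ⟨hx, h⟩ := (hfacet v hv).1 h
    exact ⟨hx, v, hv, h⟩

theorem continuousOn_bdry {Z : Type*} [TopologicalSpace Z] {h : (V → ℝ) → Z}
    (hh : ∀ c' : Cell V, c'.carrier ⊆ c.carrier → c'.dim < c.dim → ContinuousOn h c'.carrier) :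
    ContinuousOn h c.bdry := by
  rw [bdry_eq_iUnion_facet]
  exact (locallyFinite_of_finite _).continuousOn_iUnion (fun _ => isClosed_carrier _)
    fun p => hh _ (facet_subset p.1.2 _) (dim_facet_lt p.1.2 _)

theorem exists_face_of_mem_bdry (hx : x ∈ c.bdry) :
    ∃ c' : Cell V, x ∈ c'.carrier ∧ c'.carrier ⊆ c.carrier ∧ c'.dim < c.dim :=
  ⟨minCell x, mem_minCell hx.1, minCell_subset hx.1, dim_minCell_lt hx⟩

open Classical in
/-- The parametrization of a box by a standard cube. -/
noncomputable def param (c : Cell V) (t : Fin c.dim → I) (v : V) : ℝ :=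
  if h : v ∈ c.dirs then c.base v + (t (c.dirs.equivFin ⟨v, h⟩) : ℝ) else c.base v

/-- The coordinates on a box, extended to all points by clamping. -/
noncomputable def coord (c : Cell V) (x : V → ℝ) (i : Fin c.dim) : I :=
  projIcc 0 1 zero_le_one (x (c.dirs.equivFin.symm i) - c.base (c.dirs.equivFin.symm i))

theorem continuous_param (c : Cell V) : Continuous c.param := by
  refine continuous_pi fun v => ?_
  unfold param
  split_ifs <;> fun_prop

theorem continuous_coord (c : Cell V) : Continuous c.coord :=
  continuous_pi fun _ => continuous_projIcc.comp (by fun_prop)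

theorem param_mem (c : Cell V) (t : Fin c.dim → I) : c.param t ∈ c.carrier := by
  intro v
  by_cases h : v ∈ c.dirs
  · have ht := (t (c.dirs.equivFin ⟨v, h⟩)).2
    simp only [param, h, dite_true, not_true, false_imp_iff, and_true]
    exact ⟨by linarith [ht.1], by linarith [ht.2]⟩
  · simp [param, h]

theorem coe_coord (hx : x ∈ c.carrier) {v : V} (hv : v ∈ c.dirs) :
    (c.coord x (c.dirs.equivFin ⟨v, hv⟩) : ℝ) = x v - c.base v := by
  have hmem : x v - c.base v ∈ Icc (0 : ℝ) 1 := by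
    constructor <;> linarith [(hx v).1, (hx v).2.1]
  simp only [coord, Equiv.symm_apply_apply, projIcc_of_mem zero_le_one hmem]

theorem param_coord (hx : x ∈ c.carrier) : c.param (c.coord x) = x := by
  funext v
  by_cases h : v ∈ c.dirs
  · simp [param, h, coe_coord hx h]
  · simp [param, h, (hx v).2.2 h]

theorem coord_mem_boundary (hx : x ∈ c.bdry) : c.coord x ∈ Cube.boundary (Fin c.dim) := by
  obtain ⟨hx, v, hv, h⟩ := hx
  refine ⟨c.dirs.equivFin ⟨v, hv⟩, h.imp (fun h => ?_) fun h => ?_⟩ <;>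
    exact Subtype.ext (by simp [coe_coord hx hv, h])

theorem param_mem_bdry {t : Fin c.dim → I} (ht : t ∈ Cube.boundary (Fin c.dim)) :
    c.param t ∈ c.bdry := by
  obtain ⟨i, hi⟩ := ht
  refine ⟨c.param_mem t, c.dirs.equivFin.symm i, (c.dirs.equivFin.symm i).2, ?_⟩
  rcases hi with h | h <;> simp [param, h]

end Cell

/-! ### Extension of maps and of families of paths from the boundary of a cube -/

/-- Every map of the boundary of the `m`-cube into `S` extends to a map of the `m`-cube
into `S'`. -/
def CubeExtension (m : ℕ) {X : Type u} [TopologicalSpace X] (S S' : Set X) : Prop :=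
  ∀ φ : (Fin m → I) → X, ContinuousOn φ (Cube.boundary (Fin m)) →
    (∀ t ∈ Cube.boundary (Fin m), φ t ∈ S) →
    ∃ φ' : (Fin m → I) → X, Continuous φ' ∧ EqOn φ φ' (Cube.boundary (Fin m)) ∧ ∀ t, φ' t ∈ S'

theorem CubeExtension.mono {m : ℕ} {X : Type u} [TopologicalSpace X] {S S' T T' : Set X}
    (h : CubeExtension m S S') (hS : T ⊆ S) (hS' : S' ⊆ T') : CubeExtension m T T' := by
  intro φ hφ hT
  obtain ⟨φ', hφ', heq, hmem⟩ := h φ hφ fun t ht => hS (hT t ht)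
  exact ⟨φ', hφ', heq, fun t => hS' (hmem t)⟩

theorem isClosed_cubeBoundary (ι : Type*) [Finite ι] : IsClosed (Cube.boundary ι) := by
  simp only [Cube.boundary, ofPred_exists, ofPred_or]
  exact isClosed_iUnion_of_finite fun i =>
    (isClosed_eq (continuous_apply i) continuous_const).union
      (isClosed_eq (continuous_apply i) continuous_const)

theorem mem_cubeBoundary_succ {m : ℕ} {t : Fin (m + 1) → I} :
    t ∈ Cube.boundary (Fin (m + 1)) ↔
      (Fin.tail t, t 0) ∈ Cube.boundary (Fin m) ×ˢ univ ∪ univ ×ˢ ({0, 1} : Set I) := by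
  simp [Cube.boundary, Fin.exists_fin_succ, Fin.tail, or_comm]

/-- On `s`, the paths `γ t` depend continuously on `t` and run from `α t` to `β t`. -/
structure IsPathFamilyOn {T : Type*} {X : Type*} [TopologicalSpace T] [TopologicalSpace X]
    (s : Set T) (α β : T → X) (γ : T → C(I, X)) : Prop where
  continuousOn : ContinuousOn γ s
  source : ∀ t ∈ s, γ t 0 = α t
  target : ∀ t ∈ s, γ t 1 = β t

namespace IsPathFamilyOn

variable {T : Type*} {X : Type*} [TopologicalSpace T] [TopologicalSpace X] {s : Set T}
  {α β : T → X} {γ γ' : T → C(I, X)}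

theorem mono (h : IsPathFamilyOn s α β γ) {s' : Set T} (hs : s' ⊆ s) : IsPathFamilyOn s' α β γ :=
  ⟨h.continuousOn.mono hs, fun _ ht => h.source _ (hs ht), fun _ ht => h.target _ (hs ht)⟩

theorem congr (h : IsPathFamilyOn s α β γ) (heq : EqOn γ γ' s) : IsPathFamilyOn s α β γ' :=
  ⟨h.continuousOn.congr heq.symm, fun t ht => heq ht ▸ h.source t ht,
    fun t ht => heq ht ▸ h.target t ht⟩

theorem comp (h : IsPathFamilyOn s α β γ) {T' : Type*} [TopologicalSpace T'] {e : T' → T}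
    {s' : Set T'} (he : ContinuousOn e s') (hs : MapsTo e s' s) :
    IsPathFamilyOn s' (α ∘ e) (β ∘ e) (γ ∘ e) :=
  ⟨h.continuousOn.comp he hs, fun _ ht => h.source _ (hs ht), fun _ ht => h.target _ (hs ht)⟩

end IsPathFamilyOn

open Classical in
/-- The map `(t, r) ↦ γ t r` on `T × I`, with the maps `α` and `β` prescribed on the two ends. -/
noncomputable def glueEnds {T : Type*} {X : Type*} [TopologicalSpace X] (α β : T → X)
    (γ : T → C(I, X)) (p : T × I) : X :=
  if p.2 = 0 then α p.1 else if p.2 = 1 then β p.1 else γ p.1 p.2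

section GlueEnds

variable {T : Type*} {X : Type*} [TopologicalSpace X] {α β : T → X}
  {γ : T → C(I, X)}

theorem glueEnds_zero (t : T) : glueEnds α β γ (t, 0) = α t := if_pos rfl

theorem glueEnds_one (t : T) : glueEnds α β γ (t, 1) = β t :=
  (if_neg one_ne_zero).trans (if_pos rfl)

variable [TopologicalSpace T] {s : Set T}

theorem IsPathFamilyOn.glueEnds_eq (h : IsPathFamilyOn s α β γ) {t : T} (ht : t ∈ s) (r : I) :
    glueEnds α β γ (t, r) = γ t r := by
  unfold glueEnds
  split_ifs with h0 h1
  · rw [show r = 0 from h0, h.source t ht]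
  · rw [show r = 1 from h1, h.target t ht]
  · rfl

theorem IsPathFamilyOn.continuousOn_glueEnds (h : IsPathFamilyOn s α β γ) (hs : IsClosed s)
    (hα : Continuous α) (hβ : Continuous β) :
    ContinuousOn (glueEnds α β γ) (s ×ˢ univ ∪ univ ×ˢ {0, 1}) := by
  have hside : ContinuousOn (glueEnds α β γ) (s ×ˢ univ) := by
    refine (continuous_eval.comp_continuousOn ((h.continuousOn.comp continuousOn_fst
      fun p hp => hp.1).prodMk continuousOn_snd)).congr ?_
    exact fun p hp => h.glueEnds_eq hp.1 p.2
  have hbot : ContinuousOn (glueEnds α β γ) (univ ×ˢ {0}) := by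
    refine (hα.comp continuous_fst).continuousOn.congr ?_
    rintro ⟨t, _⟩ ⟨-, rfl⟩
    exact glueEnds_zero t
  have htop : ContinuousOn (glueEnds α β γ) (univ ×ˢ {1}) := by
    refine (hβ.comp continuous_fst).continuousOn.congr ?_
    rintro ⟨t, _⟩ ⟨-, rfl⟩
    exact glueEnds_one t
  have hclosed : ∀ r : I, IsClosed (univ ×ˢ {r} : Set (T × I)) := fun r =>
    isClosed_univ.prod isClosed_singleton
  rw [← singleton_union, prod_union]
  exact hside.union_of_isClosed (hbot.union_of_isClosed htop (hclosed 0) (hclosed 1))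
    (hs.prod isClosed_univ) ((hclosed 0).union (hclosed 1))

end GlueEnds

theorem CubeExtension.exists_paths {m : ℕ} {X : Type u} [TopologicalSpace X] {S S' : Set X}
    (h : CubeExtension (m + 1) S S') {α β : (Fin m → I) → X} (hα : Continuous α)
    (hβ : Continuous β) (hαS : ∀ t, α t ∈ S) (hβS : ∀ t, β t ∈ S) {γ : (Fin m → I) → C(I, X)}
    (hγ : IsPathFamilyOn (Cube.boundary (Fin m)) α β γ)
    (hγS : ∀ t ∈ Cube.boundary (Fin m), ∀ r, γ t r ∈ S) :
    ∃ γ' : (Fin m → I) → C(I, X), IsPathFamilyOn univ α β γ' ∧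
      EqOn γ γ' (Cube.boundary (Fin m)) ∧ ∀ t r, γ' t r ∈ S' := by
  let split : (Fin (m + 1) → I) → (Fin m → I) × I := fun t => (Fin.tail t, t 0)
  have hsplit : Continuous split :=
    (continuous_pi fun i => continuous_apply i.succ).prodMk (continuous_apply 0)
  obtain ⟨φ', hφ', heq, hmem⟩ := h (glueEnds α β γ ∘ split)
    ((hγ.continuousOn_glueEnds (isClosed_cubeBoundary _) hα hβ).comp hsplit.continuousOn
      fun _ => mem_cubeBoundary_succ.1) <| by
    intro t ht
    rcases mem_cubeBoundary_succ.1 ht with ⟨ht, -⟩ | ⟨-, ht | ht⟩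
    · simpa only [Function.comp_apply, split, hγ.glueEnds_eq ht] using hγS _ ht _
    · simpa only [Function.comp_apply, split, show t 0 = 0 from ht, glueEnds_zero] using hαS _
    · simpa only [Function.comp_apply, split, show t 0 = 1 from ht, glueEnds_one] using hβS _
  let Γ : C((Fin m → I) × I, X) := ⟨fun p => φ' (Fin.cons p.2 p.1),
    hφ'.comp (Continuous.finCons (A := fun _ => I) continuous_snd continuous_fst)⟩
  have hΓ : ∀ p ∈ Cube.boundary (Fin m) ×ˢ univ ∪ univ ×ˢ ({0, 1} : Set I),
      Γ p = glueEnds α β γ p := fun p hp =>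
    (heq (mem_cubeBoundary_succ.2 (by simpa only [Fin.tail_cons, Fin.cons_zero] using hp))).symm
  refine ⟨Γ.curry, ⟨Γ.curry.continuous.continuousOn, fun t _ => ?_, fun t _ => ?_⟩,
    fun t ht => ?_, fun t r => hmem _⟩
  · exact (hΓ (t, 0) (by simp)).trans (glueEnds_zero t)
  · exact (hΓ (t, 1) (by simp)).trans (glueEnds_one t)
  · ext r
    exact ((hΓ (t, r) (by simp [ht])).trans (hγ.glueEnds_eq ht r)).symm

namespace Cell

variable {V : Type w} {X : Type u} [TopologicalSpace X] {S S' : Set X} (c : Cell V)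

theorem exists_extension (hS : CubeExtension c.dim S S') {h : (V → ℝ) → X}
    (hc : ContinuousOn h c.bdry) (hb : ∀ x ∈ c.bdry, h x ∈ S) :
    ∃ h' : (V → ℝ) → X, EqOn h h' c.bdry ∧ ContinuousOn h' c.carrier ∧
      ∀ x ∈ c.carrier, h' x ∈ S' := by
  obtain ⟨φ', hφ', heq, hmem⟩ := hS (h ∘ c.param)
    (hc.comp c.continuous_param.continuousOn fun t ht => param_mem_bdry ht)
    fun t ht => hb _ (param_mem_bdry ht)
  refine ⟨φ' ∘ c.coord, fun x hx => ?_, (hφ'.comp c.continuous_coord).continuousOn,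
    fun x _ => hmem _⟩
  simp only [Function.comp_apply, ← heq (coord_mem_boundary hx), param_coord hx.1]

theorem exists_paths (hS : CubeExtension (c.dim + 1) S S') {α β : (V → ℝ) → X}
    (hα : ContinuousOn α c.carrier) (hβ : ContinuousOn β c.carrier)
    (hαS : ∀ x ∈ c.carrier, α x ∈ S) (hβS : ∀ x ∈ c.carrier, β x ∈ S)
    {γ : (V → ℝ) → C(I, X)} (hγ : IsPathFamilyOn c.bdry α β γ)
    (hγS : ∀ x ∈ c.bdry, ∀ r, γ x r ∈ S) :
    ∃ γ' : (V → ℝ) → C(I, X), EqOn γ γ' c.bdry ∧ IsPathFamilyOn c.carrier α β γ' ∧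
      ∀ x ∈ c.carrier, ∀ r, γ' x r ∈ S' := by
  have hparam : MapsTo c.param (Cube.boundary (Fin c.dim)) c.bdry := fun t ht => param_mem_bdry ht
  obtain ⟨γ', hγ', heq, hmem⟩ := hS.exists_paths
    (hα.comp_continuous c.continuous_param c.param_mem)
    (hβ.comp_continuous c.continuous_param c.param_mem)
    (fun t => hαS _ (c.param_mem t)) (fun t => hβS _ (c.param_mem t))
    (hγ.comp c.continuous_param.continuousOn hparam) fun t ht => hγS _ (hparam ht)
  refine ⟨γ' ∘ c.coord, fun x hx => ?_,
    ⟨hγ'.continuousOn.comp c.continuous_coord.continuousOn (mapsTo_univ _ _), fun x hx => ?_,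
      fun x hx => ?_⟩, fun x _ => hmem _⟩
  · simp only [Function.comp_apply, ← heq (coord_mem_boundary hx), param_coord hx.1]
  · simp only [Function.comp_apply, hγ'.source _ (mem_univ _), param_coord hx]
  · simp only [Function.comp_apply, hγ'.target _ (mem_univ _), param_coord hx]

end Cell

/-! ### Chains of extension properties -/

/-- An increasing chain of sets `S 0 ⊆ S 1 ⊆ ⋯ ⊆ S n` such that maps of the boundary of the
`(i + 1)`-cube into `S i` extend to maps of the cube into `S (i + 1)`. -/
def IsExtensionChain (n : ℕ) {X : Type u} [TopologicalSpace X] (S : ℕ → Set X) : Prop :=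
  ∀ i < n, S i ⊆ S (i + 1) ∧ CubeExtension (i + 1) (S i) (S (i + 1))

theorem IsExtensionChain.subset {n : ℕ} {X : Type u} [TopologicalSpace X] {S : ℕ → Set X}
    (hS : IsExtensionChain n S) {i j : ℕ} (hij : i ≤ j) (hj : j ≤ n) : S i ⊆ S j := by
  induction j, hij using Nat.le_induction with
  | base => rfl
  | succ j _ ih => exact (ih (Nat.le_of_succ_le hj)).trans (hS j hj).1

/-- Every open cover `𝒰` has a refinement `𝒲` such that maps of boundaries of cubes of dimension
at most `n` into the preimage of a member of `𝒲` extend to maps of the cubes into the preimage of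
a member of `𝒰`. -/
def HasLocalExtensions (n : ℕ) {X : Type u} {Y : Type v} [TopologicalSpace X] [TopologicalSpace Y]
    (f : X → Y) : Prop :=
  ∀ 𝒰 : Set (Set Y), IsOpenCovering 𝒰 → ∃ 𝒲 : Set (Set Y), IsOpenCovering 𝒲 ∧
    ∀ W ∈ 𝒲, ∃ U ∈ 𝒰, f ⁻¹' W ⊆ f ⁻¹' U ∧ ∀ k < n, CubeExtension (k + 1) (f ⁻¹' W) (f ⁻¹' U)

/-- A choice of an extension chain `S D` for every subset `D` of `Y` that is contained in a member
of `𝒱` and meets the image of `f`. The chain starts above the preimage of `D` and ends in the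
preimage of a member of `𝒰` that contains `D`. -/
structure IsExtensionSystem (n : ℕ) {X : Type u} {Y : Type v} [TopologicalSpace X] (f : X → Y)
    (𝒱 𝒰 : Set (Set Y)) (S : Set Y → ℕ → Set X) : Prop where
  mono : Monotone S
  preimage_subset {V D : Set Y} : V ∈ 𝒱 → D ⊆ V → (f ⁻¹' D).Nonempty → f ⁻¹' D ⊆ S D 0
  chain {V D : Set Y} : V ∈ 𝒱 → D ⊆ V → (f ⁻¹' D).Nonempty → IsExtensionChain n (S D)
  exists_subset {V D : Set Y} : V ∈ 𝒱 → D ⊆ V → (f ⁻¹' D).Nonempty →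
    ∃ U ∈ 𝒰, D ⊆ U ∧ S D n ⊆ f ⁻¹' U

section Chains

variable {n : ℕ} {X : Type u} {Y : Type v} [TopologicalSpace X] [PseudoMetricSpace Y] {f : X → Y}

theorem HasLocalExtensions.exists_star_refinement (hf : HasLocalExtensions n f)
    {𝒰 : Set (Set Y)} (h𝒰 : IsOpenCovering 𝒰) :
    ∃ 𝒱 : Set (Set Y), IsOpenCovering 𝒱 ∧ ∀ V ∈ 𝒱, (f ⁻¹' V).Nonempty → ∃ U ∈ 𝒰,
      starOf V 𝒱 ⊆ U ∧ ∀ k < n, CubeExtension (k + 1) (f ⁻¹' starOf V 𝒱) (f ⁻¹' U) := by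
  obtain ⟨𝒰', h𝒰', hstar⟩ := h𝒰.exists_star_refinement
  obtain ⟨𝒲, h𝒲, hext⟩ := hf 𝒰' h𝒰'
  obtain ⟨𝒱, h𝒱, hstar'⟩ := (h𝒲.inter h𝒰').exists_star_refinement
  refine ⟨𝒱, h𝒱, fun V hV ⟨x, hx⟩ => ?_⟩
  obtain ⟨_, ⟨W, hW, U₁, hU₁, rfl⟩, hVWU⟩ := hstar' V hV
  obtain ⟨U₂, hU₂, hWU₂, hcube⟩ := hext W hW
  obtain ⟨U, hU, hU₂U⟩ := hstar U₂ hU₂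
  obtain ⟨hxW, hxU₁⟩ := hVWU (subset_starOf hV ⟨f x, hx, hx⟩ hx)
  have hxU₂ : f x ∈ U₂ := hWU₂ hxW
  have hstarW : starOf V 𝒱 ⊆ W := hVWU.trans inter_subset_left
  refine ⟨U, hU, ?_, fun k hk => (hcube k hk).mono (preimage_mono hstarW) (preimage_mono ?_)⟩
  · exact (hVWU.trans inter_subset_right).trans
      ((subset_starOf hU₁ ⟨f x, hxU₁, hxU₂⟩).trans hU₂U)
  · exact (subset_starOf hU₂ ⟨f x, hxU₂, hxU₂⟩).trans hU₂U

theorem HasLocalExtensions.exists_extensionSystem (hf : HasLocalExtensions n f)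
    {𝒰 : Set (Set Y)} (h𝒰 : IsOpenCovering 𝒰) :
    ∃ (𝒱 : Set (Set Y)) (S : Set Y → ℕ → Set X),
      IsOpenCovering 𝒱 ∧ IsExtensionSystem n f 𝒱 𝒰 S := by
  obtain ⟨𝒱, hlast, hcov, hnext⟩ :=
    exists_seq_of_forall_exists (fun _ => hf.exists_star_refinement) (n + 1) h𝒰
  have hself : ∀ {i} {V D : Set Y}, V ∈ 𝒱 i → D ⊆ V → (f ⁻¹' D).Nonempty → V ⊆ starOf D (𝒱 i) :=
    fun hV hD ⟨x, hx⟩ => subset_starOf hV ⟨f x, hD hx, hx⟩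
  have hmem : ∀ {V D : Set Y}, V ∈ 𝒱 0 → D ⊆ V → (f ⁻¹' D).Nonempty →
      ∀ i ≤ n + 1, ∃ V ∈ 𝒱 i, D ⊆ V := by
    intro V D hV hD hne i
    induction i with
    | zero => exact fun _ => ⟨V, hV, hD⟩
    | succ i ih =>
      intro hi
      obtain ⟨V, hV, hD⟩ := ih (Nat.le_of_succ_le hi)
      obtain ⟨U, hU, hVU, -⟩ := hnext i hi V hV (hne.mono (preimage_mono hD))
      exact ⟨U, hU, hD.trans ((hself hV hD hne).trans ((starOf_mono hD _).trans hVU))⟩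
  have hstep : ∀ {V D : Set Y}, V ∈ 𝒱 0 → D ⊆ V → (f ⁻¹' D).Nonempty → ∀ i < n + 1,
      ∃ U ∈ 𝒱 (i + 1), D ⊆ U ∧ starOf D (𝒱 i) ⊆ U ∧
        ∀ k < n, CubeExtension (k + 1) (f ⁻¹' starOf D (𝒱 i)) (f ⁻¹' U) := by
    intro V D hV hD hne i hi
    obtain ⟨V, hV, hD⟩ := hmem hV hD hne i hi.le
    obtain ⟨U, hU, hVU, hcube⟩ := hnext i hi V hV (hne.mono (preimage_mono hD))
    have hstar : starOf D (𝒱 i) ⊆ starOf V (𝒱 i) := starOf_mono hD _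
    exact ⟨U, hU, hD.trans ((hself hV hD hne).trans (hstar.trans hVU)), hstar.trans hVU,
      fun k hk => (hcube k hk).mono (preimage_mono hstar) subset_rfl⟩
  refine ⟨𝒱 0, fun D i => f ⁻¹' starOf D (𝒱 i), hcov 0, fun D D' h i =>
    preimage_mono (starOf_mono h _), fun hV hD hne => preimage_mono (hD.trans (hself hV hD hne)),
    fun hV hD hne i hi => ?_, fun hV hD hne => ?_⟩
  · obtain ⟨U, hU, hDU, hstar, hcube⟩ := hstep hV hD hne i (hi.trans n.lt_succ_self)
    have hUstar := hself hU hDU hne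
    exact ⟨preimage_mono (hstar.trans hUstar),
      (hcube i hi).mono subset_rfl (preimage_mono hUstar)⟩
  · obtain ⟨U, hU, hDU, hstar, -⟩ := hstep hV hD hne n n.lt_succ_self
    exact ⟨U, hlast ▸ hU, hDU, preimage_mono hstar⟩

end Chains

namespace Cell

variable {V : Type w} {X : Type u} [TopologicalSpace X] {n : ℕ} {𝒞 : Set (Cell V)}
  {T : Cell V → ℕ → Set X}

theorem exists_carried_map [Nonempty X] (hdim : ∀ c ∈ 𝒞, c.dim ≤ n) (hface : IsFaceClosed 𝒞)
    (hmono : ∀ c ∈ 𝒞, ∀ c' : Cell V, c'.carrier ⊆ c.carrier → T c' ≤ T c)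
    (hchain : ∀ c ∈ 𝒞, IsExtensionChain n (T c)) (hne : ∀ c ∈ 𝒞, (T c 0).Nonempty) :
    ∃ h : (V → ℝ) → X, ∀ c ∈ 𝒞, ContinuousOn h c.carrier ∧ ∀ x ∈ c.carrier, h x ∈ T c c.dim := by
  refine exists_forall_of_extension (fun c hc => Nat.lt_succ_of_le (hdim c hc)) hface _
    (fun c _ h h' heq hh => ⟨hh.1.congr heq.symm, fun x hx => heq hx ▸ hh.2 x hx⟩)
    fun c hc h hh => ?_
  rcases hk : c.dim with _ | k
  · obtain ⟨z, hz⟩ := hne c hc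
    refine ⟨fun _ => z, fun x ⟨_, v, hv, _⟩ => ?_, continuousOn_const, fun _ _ => hz⟩
    exact absurd hv (by simp [Finset.card_eq_zero.1 hk])
  · have hkn : k < n := hk.ge.trans (hdim c hc)
    refine c.exists_extension (by simpa only [hk] using (hchain c hc k hkn).2)
      (continuousOn_bdry fun c' hc' hlt => (hh c' hc' hlt).1) fun x hx => ?_
    obtain ⟨c', hxc', hc', hlt⟩ := exists_face_of_mem_bdry hx
    exact (hchain c hc).subset (Nat.lt_succ_iff.1 (hlt.trans_eq hk)) hkn.le
      (hmono c hc c' hc' _ ((hh c' hc' hlt).2 x hxc'))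

theorem exists_carried_paths (hdim : ∀ c ∈ 𝒞, c.dim < n) (hface : IsFaceClosed 𝒞)
    (hmono : ∀ c ∈ 𝒞, ∀ c' : Cell V, c'.carrier ⊆ c.carrier → T c' ≤ T c)
    (hchain : ∀ c ∈ 𝒞, IsExtensionChain n (T c)) {L : Set (V → ℝ)}
    (hL : ∀ c ∈ 𝒞, c.carrier ⊆ L ∨ c.carrier ∩ L ⊆ c.bdry) {α β : (V → ℝ) → X}
    (hα : ∀ c ∈ 𝒞, ContinuousOn α c.carrier) (hβ : ∀ c ∈ 𝒞, ContinuousOn β c.carrier)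
    (hαT : ∀ c ∈ 𝒞, ∀ x ∈ c.carrier, α x ∈ T c 0) (hβT : ∀ c ∈ 𝒞, ∀ x ∈ c.carrier, β x ∈ T c 0)
    {γ : (V → ℝ) → C(I, X)} (hγ : IsPathFamilyOn L α β γ)
    (hγT : ∀ c ∈ 𝒞, ∀ x ∈ c.carrier ∩ L, ∀ r, γ x r ∈ T c 0) :
    ∃ γ' : (V → ℝ) → C(I, X), ∀ c ∈ 𝒞, IsPathFamilyOn c.carrier α β γ' ∧
      EqOn γ γ' (c.carrier ∩ L) ∧ ∀ x ∈ c.carrier, ∀ r, γ' x r ∈ T c (c.dim + 1) := by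
  have : Nonempty C(I, X) := ⟨γ 0⟩
  refine exists_forall_of_extension hdim hface _ (fun c _ h h' heq hh => ⟨hh.1.congr heq,
    hh.2.1.trans (heq.mono inter_subset_left), fun x hx => heq hx ▸ hh.2.2 x hx⟩)
    fun c hc h hh => ?_
  have hstep : ∀ {i j}, i ≤ j → j ≤ c.dim + 1 → T c i ⊆ T c j := fun hij hj =>
    (hchain c hc).subset hij (hj.trans (hdim c hc))
  have heqL : EqOn γ h (c.bdry ∩ L) := by
    intro x hx
    obtain ⟨c', hxc', hc', hlt⟩ := exists_face_of_mem_bdry hx.1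
    exact (hh c' hc' hlt).2.1 ⟨hxc', hx.2⟩
  rcases hL c hc with hcL | hcL
  · exact ⟨γ, fun x hx => (heqL ⟨hx, hcL hx.1⟩).symm, hγ.mono hcL, fun _ _ => rfl,
      fun x hx r => hstep (Nat.zero_le _) le_rfl (hγT c hc x ⟨hx, hcL hx⟩ r)⟩
  · have hbdry : IsPathFamilyOn c.bdry α β h := by
      refine ⟨continuousOn_bdry fun c' hc' hlt => (hh c' hc' hlt).1.continuousOn, ?_, ?_⟩ <;>
        intro x hx <;> obtain ⟨c', hxc', hc', hlt⟩ := exists_face_of_mem_bdry hx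
      · exact (hh c' hc' hlt).1.source x hxc'
      · exact (hh c' hc' hlt).1.target x hxc'
    obtain ⟨γ', heq, hγ', hmem⟩ := c.exists_paths (hchain c hc c.dim (hdim c hc)).2 (hα c hc)
      (hβ c hc) (fun x hx => hstep (Nat.zero_le _) (Nat.le_succ _) (hαT c hc x hx))
      (fun x hx => hstep (Nat.zero_le _) (Nat.le_succ _) (hβT c hc x hx)) hbdry fun x hx r => by
        obtain ⟨c', hxc', hc', hlt⟩ := exists_face_of_mem_bdry hx
        exact hstep hlt (Nat.le_succ _) (hmono c hc c' hc' _ ((hh c' hc' hlt).2.2 x hxc' r))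
    exact ⟨γ', heq, hγ', fun x hx => (heqL ⟨hcL hx, hx.2⟩).trans (heq (hcL hx)), hmem⟩

end Cell

/-! ### Controlled homotopies over a cube -/

/-- The points of `X` that a family of paths `γ` over `s` from `α` to `β`, together with `α` and
`β` themselves, visits over the parameters in `A`. -/
def trace {T : Type*} {X : Type*} [TopologicalSpace X] (s : Set T) (α β : T → X) (γ : T → C(I, X))
    (A : Set T) : Set X :=
  α '' A ∪ β '' A ∪ ⋃ t ∈ A ∩ s, range (γ t)

section Trace

variable {T : Type*} {X : Type*} [TopologicalSpace X] {s A A' : Set T} {α β : T → X}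
  {γ : T → C(I, X)}

theorem trace_subset_iff {W : Set X} :
    trace s α β γ A ⊆ W ↔
      (∀ t ∈ A, α t ∈ W ∧ β t ∈ W) ∧ ∀ t ∈ A ∩ s, ∀ r, γ t r ∈ W := by
  simp only [trace, union_subset_iff, image_subset_iff, iUnion₂_subset_iff, range_subset_iff,
    forall₂_and]
  rfl

theorem trace_mono (h : A ⊆ A') : trace s α β γ A ⊆ trace s α β γ A' :=
  have H := trace_subset_iff.1 (Subset.refl (trace s α β γ A'))
  trace_subset_iff.2 ⟨fun t ht => H.1 t (h ht), fun t ht => H.2 t ⟨h ht.1, ht.2⟩⟩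

theorem exists_isOpen_trace_subset [TopologicalSpace T] (hs : IsClosed s) (hα : Continuous α)
    (hβ : Continuous β) (hγ : ContinuousOn γ s) {W : Set X} (hW : IsOpen W) {t : T}
    (ht : trace s α β γ {t} ⊆ W) : ∃ O : Set T, IsOpen O ∧ t ∈ O ∧ trace s α β γ O ⊆ W := by
  obtain ⟨O, hO, heq⟩ := continuousOn_iff'.1 hγ _
    (ContinuousMap.isOpen_setOfPred_mapsTo isCompact_univ hW)
  obtain ⟨hends, hpath⟩ := trace_subset_iff.1 ht
  refine ⟨α ⁻¹' W ∩ β ⁻¹' W ∩ (sᶜ ∪ O),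
    ((hW.preimage hα).inter (hW.preimage hβ)).inter (hs.isOpen_compl.union hO),
    ⟨hends t rfl, ?_⟩, trace_subset_iff.2 ⟨fun _ ht' => ht'.1, fun t' ht' r => ?_⟩⟩
  · refine or_iff_not_imp_left.2 fun hts => ?_
    exact (heq.subset ⟨fun r _ => hpath t ⟨rfl, not_not.1 hts⟩ r, not_not.1 hts⟩).1
  · exact (heq.superset ⟨ht'.1.2.resolve_left (not_not.2 ht'.2), ht'.2⟩).1 (mem_univ r)

end Trace

/-- Homotopies `γ` over the boundary of the `j`-cube, between maps `α` and `β` of the `j`-cube into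
`X` that are `𝒱`-close as seen through `f`, extend over the `j`-cube; the size of the homotopies,
measured through `f`, grows from `𝒱` to `𝒰`. -/
def HomotopyExtension (j : ℕ) {X : Type u} {Y : Type v} [TopologicalSpace X] (f : X → Y)
    (𝒱 𝒰 : Set (Set Y)) : Prop :=
  ∀ (α β : (Fin j → I) → X) (γ : (Fin j → I) → C(I, X)), Continuous α → Continuous β →
    (∀ t, ∃ V ∈ 𝒱, f (α t) ∈ V ∧ f (β t) ∈ V) →
    IsPathFamilyOn (Cube.boundary (Fin j)) α β γ →
    (∀ t ∈ Cube.boundary (Fin j), ∃ V ∈ 𝒱, ∀ r, f (γ t r) ∈ V) →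
    ∃ γ' : (Fin j → I) → C(I, X), IsPathFamilyOn univ α β γ' ∧
      EqOn γ γ' (Cube.boundary (Fin j)) ∧ ∀ t, ∃ U ∈ 𝒰, ∀ r, f (γ' t r) ∈ U

/-- The map of the standard cube, scaled by `N`, onto the standard cube, extended to all points by
clamping. -/
noncomputable def unscale {j : ℕ} (N : ℕ) (x : Fin j → ℝ) : Fin j → I :=
  fun i => projIcc 0 1 zero_le_one (x i / N)

/-- The boxes contained in the standard cube scaled by `N`. -/
def gridCells (j N : ℕ) : Set (Cell (Fin j)) :=
  {c | ∀ x ∈ c.carrier, ∀ i, x i ∈ Icc (0 : ℝ) N}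

/-- The top-dimensional boxes of the standard cube scaled by `N`. -/
def gridCell {j N : ℕ} (k : Fin j → Fin N) : Cell (Fin j) where
  base i := (k i : ℕ)
  dirs := Finset.univ

section Grid

variable {j N : ℕ}

theorem continuous_unscale : Continuous (unscale (j := j) N) :=
  continuous_pi fun _ => continuous_projIcc.comp (by fun_prop)

theorem unscale_scale (hN : 0 < N) (t : Fin j → I) : unscale N (fun i => N * (t i : ℝ)) = t := by
  have hN' : (N : ℝ) ≠ 0 := by exact_mod_cast hN.ne'
  funext i
  simp [unscale, hN']

theorem dist_unscale_le {c : Cell (Fin j)} {x z : Fin j → ℝ} (hx : x ∈ c.carrier)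
    (hz : z ∈ c.carrier) : dist (unscale N x) (unscale N z) ≤ 1 / N := by
  refine (dist_pi_le_iff (by positivity)).2 fun i => ?_
  rw [Subtype.dist_eq, Real.dist_eq]
  refine (abs_projIcc_sub_projIcc zero_le_one).trans ?_
  rw [← sub_div, abs_div, Nat.abs_cast]
  gcongr
  obtain ⟨h1, h2, -⟩ := hx i
  obtain ⟨h3, h4, -⟩ := hz i
  exact abs_le.2 ⟨by linarith, by linarith⟩

theorem isFaceClosed_gridCells : Cell.IsFaceClosed (gridCells j N) :=
  fun _ hc _ hc' x hx => hc x (hc' hx)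

theorem exists_mem_gridCell (hN : 0 < N) {x : Fin j → ℝ} (hx : ∀ i, x i ∈ Icc (0 : ℝ) N) :
    ∃ k : Fin j → Fin N, x ∈ (gridCell k).carrier := by
  have hcoord : ∀ i, ∃ k : Fin N, ((k : ℕ) : ℝ) ≤ x i ∧ x i ≤ (k : ℕ) + 1 := by
    intro i
    obtain ⟨h0, h1⟩ := hx i
    rcases h1.lt_or_eq with h1 | h1
    · exact ⟨⟨⌊x i⌋₊, (Nat.floor_lt h0).2 h1⟩, Nat.floor_le h0, (Nat.lt_floor_add_one _).le⟩
    · refine ⟨⟨N - 1, Nat.sub_one_lt hN.ne'⟩, ?_⟩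
      simp [h1, Nat.cast_pred hN]
  choose k hk using hcoord
  exact ⟨k, fun i => ⟨(hk i).1, (hk i).2, fun h => absurd (Finset.mem_univ i) h⟩⟩

theorem gridCell_mem (k : Fin j → Fin N) : gridCell k ∈ gridCells j N := by
  intro x hx i
  obtain ⟨hl, hr, -⟩ := hx i
  have hk : ((k i : ℕ) : ℝ) + 1 ≤ N := by exact_mod_cast (k i).2
  exact ⟨(Nat.cast_nonneg _).trans hl, hr.trans hk⟩

theorem carrier_subset_or_inter_subset_bdry (hN : 0 < N) {c : Cell (Fin j)}
    (hc : c ∈ gridCells j N) :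
    c.carrier ⊆ unscale N ⁻¹' Cube.boundary (Fin j) ∨
      c.carrier ∩ unscale N ⁻¹' Cube.boundary (Fin j) ⊆ c.bdry := by
  have hN' : (0 : ℝ) < N := by exact_mod_cast hN
  have hzero : ∀ {x : Fin j → ℝ} {i}, unscale N x i = 0 ↔ x i ≤ 0 := fun {x i} =>
    (projIcc_eq_left zero_lt_one).trans (by rw [div_le_iff₀ hN', zero_mul])
  have hone : ∀ {x : Fin j → ℝ} {i}, unscale N x i = 1 ↔ N ≤ x i := fun {x i} =>
    (projIcc_eq_right zero_lt_one).trans (one_le_div hN')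
  by_cases h : ∃ i ∉ c.dirs, (c.base i : ℝ) ≤ 0 ∨ (N : ℝ) ≤ c.base i
  · obtain ⟨i, hi, h⟩ := h
    refine Or.inl fun x hx => ⟨i, ?_⟩
    rwa [hzero, hone, (hx i).2.2 hi]
  · push Not at h
    refine Or.inr fun x ⟨hx, i, hxi⟩ => ?_
    rw [hzero, hone] at hxi
    have hi : i ∈ c.dirs := by
      by_contra hi
      obtain ⟨h0, h1⟩ := h i hi
      rw [(hx i).2.2 hi] at hxi
      exact hxi.elim h0.not_ge h1.not_ge
    have htop : (c.base i : ℝ) + 1 ≤ N := by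
      simpa [Cell.param, hi] using (hc _ (c.param_mem fun _ => 1) i).2
    refine ⟨hx, i, hi, hxi.imp (fun h => ?_) fun h => ?_⟩
    · exact (h.trans (hc _ c.base_mem_carrier i).1).antisymm (hx i).1
    · exact (hx i).2.1.antisymm (htop.trans h)

variable {X : Type u} [TopologicalSpace X] {α β : (Fin j → I) → X} {γ : (Fin j → I) → C(I, X)}

theorem exists_forall_trace_unscale_subset {𝒪 : Set (Set X)} (h𝒪 : ∀ W ∈ 𝒪, IsOpen W)
    (hα : Continuous α) (hβ : Continuous β) (hγ : ContinuousOn γ (Cube.boundary (Fin j)))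
    (htrace : ∀ t, ∃ W ∈ 𝒪, trace (Cube.boundary (Fin j)) α β γ {t} ⊆ W) :
    ∃ N > 0, ∀ c : Cell (Fin j), ∃ W ∈ 𝒪,
      trace (Cube.boundary (Fin j)) α β γ (unscale N '' c.carrier) ⊆ W := by
  choose W hW hWt using htrace
  choose O hO htO hOW using fun t => exists_isOpen_trace_subset (isClosed_cubeBoundary (Fin j))
    hα hβ hγ (h𝒪 _ (hW t)) (hWt t)
  obtain ⟨δ, hδ, hball⟩ := lebesgue_number_lemma_of_metric (s := (univ : Set (Fin j → I)))
    isCompact_univ hO fun t _ => mem_iUnion.2 ⟨t, htO t⟩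
  obtain ⟨N, hN⟩ := exists_nat_one_div_lt hδ
  refine ⟨N + 1, N.succ_pos, fun c => ?_⟩
  obtain ⟨t, ht⟩ := hball (unscale (N + 1) fun i => (c.base i : ℝ)) (mem_univ _)
  refine ⟨W t, hW t, (trace_mono ?_).trans (hOW t)⟩
  rintro _ ⟨x, hx, rfl⟩
  refine ht ((dist_unscale_le hx c.base_mem_carrier).trans_lt ?_)
  exact_mod_cast hN

theorem exists_paths_of_gridCells {n : ℕ} (hj : j < n) (hN : 0 < N) {T : Cell (Fin j) → ℕ → Set X}
    (hmono : ∀ c ∈ gridCells j N, ∀ c' : Cell (Fin j), c'.carrier ⊆ c.carrier → T c' ≤ T c)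
    (hchain : ∀ c ∈ gridCells j N, IsExtensionChain n (T c)) (hα : Continuous α)
    (hβ : Continuous β) (hγ : IsPathFamilyOn (Cube.boundary (Fin j)) α β γ)
    (htrace : ∀ c ∈ gridCells j N,
      trace (Cube.boundary (Fin j)) α β γ (unscale N '' c.carrier) ⊆ T c 0) :
    ∃ γ' : (Fin j → I) → C(I, X), IsPathFamilyOn univ α β γ' ∧
      EqOn γ γ' (Cube.boundary (Fin j)) ∧ ∀ t, ∃ c ∈ gridCells j N, ∀ r, γ' t r ∈ T c n := by
  have hdim : ∀ c : Cell (Fin j), c.dim < n := fun c =>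
    ((Finset.card_le_univ _).trans_eq (Fintype.card_fin j)).trans_lt hj
  have hvisit := fun c hc => trace_subset_iff.1 (htrace c hc)
  obtain ⟨h, hh⟩ := Cell.exists_carried_paths (fun c _ => hdim c) isFaceClosed_gridCells hmono
    hchain (fun c hc => carrier_subset_or_inter_subset_bdry hN hc)
    (α := α ∘ unscale N) (β := β ∘ unscale N) (γ := γ ∘ unscale N)
    (fun _ _ => (hα.comp continuous_unscale).continuousOn)
    (fun _ _ => (hβ.comp continuous_unscale).continuousOn)
    (fun c hc x hx => ((hvisit c hc).1 _ ⟨x, hx, rfl⟩).1)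
    (fun c hc x hx => ((hvisit c hc).1 _ ⟨x, hx, rfl⟩).2)
    (hγ.comp continuous_unscale.continuousOn fun _ => id)
    fun c hc x hx => (hvisit c hc).2 _ ⟨⟨x, hx.1, rfl⟩, hx.2⟩
  let scale : (Fin j → I) → Fin j → ℝ := fun t i => N * (t i : ℝ)
  have hscale : Continuous scale := by fun_prop
  have hunscale : ∀ t, unscale N (scale t) = t := unscale_scale hN
  have hcell : ∀ t, ∃ k : Fin j → Fin N, scale t ∈ (gridCell k).carrier := fun t =>
    exists_mem_gridCell hN fun i => ⟨mul_nonneg (Nat.cast_nonneg _) (t i).2.1,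
      mul_le_of_le_one_right (Nat.cast_nonneg _) (t i).2.2⟩
  have hcont : ContinuousOn h (⋃ k : Fin j → Fin N, (gridCell k).carrier) :=
    (locallyFinite_of_finite _).continuousOn_iUnion (fun _ => Cell.isClosed_carrier _)
      fun k => (hh _ (gridCell_mem k)).1.continuousOn
  refine ⟨h ∘ scale, ⟨(hcont.comp_continuous hscale fun t => mem_iUnion.2 (hcell t)).continuousOn,
    fun t _ => ?_, fun t _ => ?_⟩, fun t ht => ?_, fun t => ?_⟩ <;> obtain ⟨k, hk⟩ := hcell t
  · simpa only [Function.comp_apply, hunscale] using (hh _ (gridCell_mem k)).1.source _ hk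
  · simpa only [Function.comp_apply, hunscale] using (hh _ (gridCell_mem k)).1.target _ hk
  · simpa only [Function.comp_apply, hunscale] using
      (hh _ (gridCell_mem k)).2.1 ⟨hk, by rwa [mem_preimage, hunscale]⟩
  · exact ⟨_, gridCell_mem k, fun r => (hchain _ (gridCell_mem k)).subset (hdim _) le_rfl
      ((hh _ (gridCell_mem k)).2.2 _ hk r)⟩

end Grid

theorem HasLocalExtensions.exists_homotopyExtension {n : ℕ} {X : Type u} {Y : Type v}
    [TopologicalSpace X] [PseudoMetricSpace Y] {f : X → Y} (hf : HasLocalExtensions n f)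
    (hfc : Continuous f) {𝒰 : Set (Set Y)} (h𝒰 : IsOpenCovering 𝒰) :
    ∃ 𝒱 : Set (Set Y), IsOpenCovering 𝒱 ∧ Refines 𝒱 𝒰 ∧ ∀ j < n, HomotopyExtension j f 𝒱 𝒰 := by
  obtain ⟨𝒱, S, h𝒱, hS⟩ := hf.exists_extensionSystem h𝒰
  refine ⟨image2 (· ∩ ·) 𝒱 𝒰, h𝒱.inter h𝒰, inter_refines_right 𝒱 𝒰,
    fun j hj α β γ hα hβ hαβ hγ hγV => ?_⟩
  have hsingle : ∀ t, ∃ W ∈ preimageFamily f 𝒱,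
      trace (Cube.boundary (Fin j)) α β γ {t} ⊆ W := by
    intro t
    simp only [preimageFamily, exists_mem_image, trace_subset_iff, mem_singleton_iff, forall_eq,
      mem_inter_iff, and_imp, mem_preimage]
    by_cases ht : t ∈ Cube.boundary (Fin j)
    · obtain ⟨_, ⟨V, hV, U, -, rfl⟩, hr⟩ := hγV t ht
      exact ⟨V, hV, ⟨hγ.source t ht ▸ (hr 0).1, hγ.target t ht ▸ (hr 1).1⟩, fun _ r => (hr r).1⟩
    · obtain ⟨_, ⟨V, hV, U, -, rfl⟩, hαV, hβV⟩ := hαβ t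
      exact ⟨V, hV, ⟨hαV.1, hβV.1⟩, fun ht' => absurd ht' ht⟩
  obtain ⟨N, hN, htrace⟩ := exists_forall_trace_unscale_subset
    (forall_mem_image.2 fun V hV => (h𝒱.1 V hV).preimage hfc) hα hβ hγ.continuousOn hsingle
  let tr : Cell (Fin j) → Set X := fun c =>
    trace (Cube.boundary (Fin j)) α β γ (unscale N '' c.carrier)
  have htrV : ∀ c, ∃ V ∈ 𝒱, f '' tr c ⊆ V := fun c => by
    obtain ⟨_, ⟨V, hV, rfl⟩, h⟩ := htrace c
    exact ⟨V, hV, image_subset_iff.2 h⟩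
  have hne : ∀ c, (f ⁻¹' (f '' tr c)).Nonempty := fun c =>
    ⟨_, subset_preimage_image f _ (Or.inl (Or.inl ⟨_, ⟨_, c.base_mem_carrier, rfl⟩, rfl⟩))⟩
  choose V hV htrV using htrV
  obtain ⟨γ', hγ', heq, hmem⟩ := exists_paths_of_gridCells hj hN (T := fun c => S (f '' tr c))
    (fun _ _ _ h => hS.mono (image_mono (trace_mono (image_mono h))))
    (fun c _ => hS.chain (hV c) (htrV c) (hne c)) hα hβ hγ
    fun c _ => (subset_preimage_image f _).trans (hS.preimage_subset (hV c) (htrV c) (hne c))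
  refine ⟨γ', hγ', heq, fun t => ?_⟩
  obtain ⟨c, -, hc⟩ := hmem t
  obtain ⟨U, hU, -, hSU⟩ := hS.exists_subset (hV c) (htrV c) (hne c)
  exact ⟨U, hU, fun r => hSU (hc r)⟩

/-! ### The cubical structure of a simplicial complex -/

section Cubical

variable {V : Type w} {a b : Finset V} {x : V → ℝ}

/-- The simplex spanned by `b`, normalized so that the greatest barycentric coordinate is `1`. In
this normalization a simplex is a union of integer boxes. -/
def maxSimplex (b : Finset V) : Set (V → ℝ) :=
  {x | (∀ v, 0 ≤ x v ∧ x v ≤ 1) ∧ (∀ v ∉ b, x v = 0) ∧ ∃ v ∈ b, x v = 1}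

/-- The boxes that are contained in a simplex of `𝒦`. -/
def cubicalCells (𝒦 : Set (Finset V)) : Set (Cell V) :=
  {c | ∃ b ∈ 𝒦, c.carrier ⊆ maxSimplex b}

theorem isFaceClosed_cubicalCells (𝒦 : Set (Finset V)) : Cell.IsFaceClosed (cubicalCells 𝒦) :=
  fun _ ⟨b, hb, hcb⟩ _ h => ⟨b, hb, h.trans hcb⟩

theorem Cell.dirs_subset_and_exists_base_eq_one {c : Cell V} (h : c.carrier ⊆ maxSimplex b) :
    c.dirs ⊆ b ∧ ∃ v ∈ b, v ∉ c.dirs ∧ c.base v = 1 := by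
  let center : V → ℝ := c.param fun _ => ⟨1 / 2, by norm_num, by norm_num⟩
  have hne : ∀ v ∈ c.dirs, ∀ z : ℤ, center v ≠ z := by
    intro v hv z hz
    simp only [center, param, hv, dite_true] at hz
    have : 2 * c.base v + 1 = 2 * z := by
      exact_mod_cast (by linarith : (2 * c.base v + 1 : ℝ) = 2 * z)
    omega
  obtain ⟨-, hzero, v, hvb, hv⟩ := h (c.param_mem _)
  have hvd : v ∉ c.dirs := fun hd => hne v hd 1 (by rw [Int.cast_one, ← hv])
  refine ⟨fun z hz => ?_, v, hvb, hvd, ?_⟩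
  · by_contra hzb
    exact hne z hz 0 (by rw [Int.cast_zero, ← hzero z hzb])
  · simpa [param, hvd] using hv

theorem Cell.dim_lt_card {c : Cell V} (h : c.carrier ⊆ maxSimplex b) : c.dim < b.card := by
  obtain ⟨hdirs, v, hv, hvd, -⟩ := dirs_subset_and_exists_base_eq_one h
  exact Finset.card_lt_card ⟨hdirs, fun h => hvd (h hv)⟩

open Classical in
/-- The box of those points of the simplex `b` whose coordinates in `a` are `1`. -/
noncomputable def cornerCell (a b : Finset V) : Cell V where
  base v := if v ∈ a then 1 else 0
  dirs := b \ a

theorem cornerCell_subset (hab : a ⊆ b) (ha : a.Nonempty) :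
    (cornerCell a b).carrier ⊆ maxSimplex b := by
  intro x hx
  have hone : ∀ v ∈ a, x v = 1 := fun v hv => by
    simpa [cornerCell, hv] using (hx v).2.2
  refine ⟨fun v => ?_, fun v hv => ?_, ha.imp fun v hv => ⟨hab hv, hone v hv⟩⟩
  · by_cases hv : v ∈ a
    · simp [hone v hv]
    · simpa [cornerCell, hv] using And.intro (hx v).1 (hx v).2.1
  · have hva : v ∉ a := fun h => hv (hab h)
    simpa [cornerCell, hva, hv] using (hx v).2.2

theorem cornerCell_mem_cubicalCells {𝒦 : Set (Finset V)} (hb : b ∈ 𝒦)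
    (ha : a ∈ b.powerset.filter Finset.Nonempty) : cornerCell a b ∈ cubicalCells 𝒦 := by
  obtain ⟨hab, hne⟩ := Finset.mem_filter.1 ha
  exact ⟨b, hb, cornerCell_subset (Finset.mem_powerset.1 hab) hne⟩

theorem exists_mem_cornerCell (hx : x ∈ maxSimplex b) :
    ∃ a ∈ b.powerset.filter Finset.Nonempty, x ∈ (cornerCell a b).carrier := by
  classical
  obtain ⟨hI, hzero, v, hvb, hv⟩ := hx
  refine ⟨b.filter (x · = 1), by simpa using ⟨v, by simp [hvb, hv]⟩, fun z => ?_⟩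
  by_cases hzb : z ∈ b
  · by_cases hz : x z = 1
    · simp [cornerCell, hzb, hz]
    · simp [cornerCell, hzb, hz, hI z]
  · simp [cornerCell, hzb, hzero z hzb]

theorem exists_mem_cubicalCells {𝒦 : Set (Finset V)} (hb : b ∈ 𝒦) (hx : x ∈ maxSimplex b) :
    ∃ c ∈ cubicalCells 𝒦, x ∈ c.carrier := by
  obtain ⟨a, ha, hxa⟩ := exists_mem_cornerCell hx
  exact ⟨_, cornerCell_mem_cubicalCells hb ha, hxa⟩

theorem maxSimplex_eq_iUnion (b : Finset V) :
    maxSimplex b =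
      ⋃ a : (b.powerset.filter Finset.Nonempty : Finset (Finset V)), (cornerCell a b).carrier := by
  refine Subset.antisymm (fun x hx => ?_) (iUnion_subset fun a => ?_)
  · obtain ⟨a, ha, hxa⟩ := exists_mem_cornerCell hx
    exact mem_iUnion.2 ⟨⟨a, ha⟩, hxa⟩
  · obtain ⟨hab, hne⟩ := Finset.mem_filter.1 a.2
    exact cornerCell_subset (Finset.mem_powerset.1 hab) hne

theorem isClosed_maxSimplex (b : Finset V) : IsClosed (maxSimplex b) := by
  rw [maxSimplex_eq_iUnion]
  exact isClosed_iUnion_of_finite fun a => Cell.isClosed_carrier _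

theorem continuousOn_maxSimplex {Z : Type*} [TopologicalSpace Z] {𝒦 : Set (Finset V)}
    {h : (V → ℝ) → Z} (hh : ∀ c ∈ cubicalCells 𝒦, ContinuousOn h c.carrier) (hb : b ∈ 𝒦) :
    ContinuousOn h (maxSimplex b) := by
  rw [maxSimplex_eq_iUnion]
  exact (locallyFinite_of_finite _).continuousOn_iUnion (fun _ => Cell.isClosed_carrier _)
    fun a => hh _ (cornerCell_mem_cubicalCells hb a.2)

/-- The normalization of the sum of the coordinates to `1`. -/
noncomputable def sumNormalize (x : V → ℝ) : V → ℝ := fun v => x v / ∑ᶠ z, x z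

/-- The normalization of the greatest coordinate to `1`. -/
noncomputable def maxNormalize (x : V → ℝ) : V → ℝ := fun v => x v / ⨆ z, x z

theorem finsum_eq_sum_of_forall_notMem (hx : ∀ v ∉ b, x v = 0) : ∑ᶠ z, x z = ∑ z ∈ b, x z :=
  finsum_eq_sum_of_support_subset _ fun v hv => by_contra fun h => hv (hx v h)

theorem sum_pos_of_mem_maxSimplex (hx : x ∈ maxSimplex b) : 0 < ∑ z ∈ b, x z := by
  obtain ⟨hI, -, v, hvb, hv⟩ := hx
  exact Finset.sum_pos' (fun z _ => (hI z).1) ⟨v, hvb, hv ▸ one_pos⟩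

theorem sumNormalize_eq (hx : ∀ v ∉ b, x v = 0) :
    sumNormalize x = fun v => x v / ∑ z ∈ b, x z := by
  rw [← finsum_eq_sum_of_forall_notMem hx]
  rfl

theorem sumNormalize_mem (hx : x ∈ maxSimplex b) : sumNormalize x ∈ closedSimplex b := by
  have hpos := sum_pos_of_mem_maxSimplex hx
  rw [sumNormalize_eq hx.2.1]
  refine ⟨fun v => div_nonneg (hx.1 v).1 hpos.le, fun v hv => ?_, ?_⟩
  · simp only [hx.2.1 v hv, zero_div]
  · rw [← Finset.sum_div, div_self hpos.ne']

theorem continuousOn_sumNormalize : ContinuousOn (sumNormalize (V := V)) (maxSimplex b) := by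
  have hsum : ContinuousOn (fun (x : V → ℝ) (v : V) => x v / ∑ z ∈ b, x z) (maxSimplex b) :=
    continuousOn_pi.2 fun v => ContinuousOn.div (by fun_prop) (by fun_prop) fun x hx =>
      (sum_pos_of_mem_maxSimplex hx).ne'
  exact hsum.congr fun x hx => sumNormalize_eq hx.2.1

theorem le_sup'_of_mem_closedSimplex (hb : b.Nonempty) (hx : x ∈ closedSimplex b) (v : V) :
    x v ≤ b.sup' hb x := by
  by_cases hv : v ∈ b
  · exact Finset.le_sup' x hv
  · obtain ⟨z, hz⟩ := hb
    exact (hx.2.1 v hv).trans_le ((hx.1 z).trans (Finset.le_sup' x hz))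

theorem iSup_eq_sup'_of_mem_closedSimplex (hb : b.Nonempty) (hx : x ∈ closedSimplex b) :
    ⨆ z, x z = b.sup' hb x := by
  have hle := le_sup'_of_mem_closedSimplex hb hx
  have : Nonempty V := hb.to_type
  exact (ciSup_le hle).antisymm (Finset.sup'_le _ _ fun v _ =>
    le_ciSup ⟨b.sup' hb x, forall_mem_range.2 hle⟩ v)

theorem maxNormalize_eq (hb : b.Nonempty) (hx : x ∈ closedSimplex b) :
    maxNormalize x = fun v => x v / b.sup' hb x := by
  rw [← iSup_eq_sup'_of_mem_closedSimplex hb hx]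
  rfl

theorem sup'_pos_of_mem_closedSimplex (hb : b.Nonempty) (hx : x ∈ closedSimplex b) :
    0 < b.sup' hb x := by
  by_contra! h
  have hsum : ∑ v ∈ b, x v ≤ 0 := Finset.sum_nonpos fun v hv => (Finset.le_sup' x hv).trans h
  exact absurd (hx.2.2 ▸ hsum) one_pos.not_ge

theorem maxNormalize_mem (hb : b.Nonempty) (hx : x ∈ closedSimplex b) :
    maxNormalize x ∈ maxSimplex b := by
  have hpos := sup'_pos_of_mem_closedSimplex hb hx
  rw [maxNormalize_eq hb hx]
  refine ⟨fun v => ⟨div_nonneg (hx.1 v) hpos.le,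
    (div_le_one hpos).2 (le_sup'_of_mem_closedSimplex hb hx v)⟩, fun v hv => ?_, ?_⟩
  · simp only [hx.2.1 v hv, zero_div]
  · obtain ⟨v, hv, heq⟩ := Finset.exists_mem_eq_sup' hb x
    exact ⟨v, hv, by simp only [heq, div_self (heq ▸ hpos).ne']⟩

theorem continuousOn_maxNormalize (hb : b.Nonempty) :
    ContinuousOn (maxNormalize (V := V)) (closedSimplex b) := by
  have hsup : ContinuousOn (fun (x : V → ℝ) (v : V) => x v / b.sup' hb x) (closedSimplex b) := by
    refine continuousOn_pi.2 fun v => ContinuousOn.div (by fun_prop) ?_ fun x hx =>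
      (sup'_pos_of_mem_closedSimplex hb hx).ne'
    exact ContinuousOn.finset_sup'_apply hb fun z _ => (continuous_apply z).continuousOn
  exact hsup.congr fun x hx => maxNormalize_eq hb hx

theorem sumNormalize_maxNormalize (hb : b.Nonempty) (hx : x ∈ closedSimplex b) :
    sumNormalize (maxNormalize x) = x := by
  have hpos := sup'_pos_of_mem_closedSimplex hb hx
  rw [sumNormalize_eq (maxNormalize_mem hb hx).2.1, maxNormalize_eq hb hx, ← Finset.sum_div,
    hx.2.2]
  funext v
  field_simp

end Cubical

/-! ### Controlled homotopies over a polyhedron -/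

namespace Cell

variable {V : Type w} {X : Type u} {Y : Type v} [TopologicalSpace X] {f : X → Y}

theorem exists_controlled_paths (c : Cell V) {𝒱 𝒰 : Set (Set Y)}
    (h : HomotopyExtension c.dim f 𝒱 𝒰) {α β : (V → ℝ) → X} (hα : ContinuousOn α c.carrier)
    (hβ : ContinuousOn β c.carrier) (hαβ : ∀ x ∈ c.carrier, ∃ V ∈ 𝒱, f (α x) ∈ V ∧ f (β x) ∈ V)
    {γ : (V → ℝ) → C(I, X)} (hγ : IsPathFamilyOn c.bdry α β γ)
    (hγV : ∀ x ∈ c.bdry, ∃ V ∈ 𝒱, ∀ r, f (γ x r) ∈ V) :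
    ∃ γ' : (V → ℝ) → C(I, X), EqOn γ γ' c.bdry ∧ IsPathFamilyOn c.carrier α β γ' ∧
      ∀ x ∈ c.carrier, ∃ U ∈ 𝒰, ∀ r, f (γ' x r) ∈ U := by
  obtain ⟨γ', hγ', heq, hmem⟩ := h _ _ (γ ∘ c.param)
    (hα.comp_continuous c.continuous_param c.param_mem)
    (hβ.comp_continuous c.continuous_param c.param_mem) (fun t => hαβ _ (c.param_mem t))
    (hγ.comp c.continuous_param.continuousOn fun _ => param_mem_bdry)
    fun t ht => hγV _ (param_mem_bdry ht)
  refine ⟨γ' ∘ c.coord, fun x hx => ?_,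
    ⟨hγ'.continuousOn.comp c.continuous_coord.continuousOn (mapsTo_univ _ _), fun x hx => ?_,
      fun x hx => ?_⟩, fun x _ => hmem _⟩
  · simp only [Function.comp_apply, ← heq (coord_mem_boundary hx), param_coord hx.1]
  · simp only [Function.comp_apply, hγ'.source _ (mem_univ _), param_coord hx]
  · simp only [Function.comp_apply, hγ'.target _ (mem_univ _), param_coord hx]

theorem exists_controlled_homotopy {n : ℕ} {𝒞 : Set (Cell V)} (hdim : ∀ c ∈ 𝒞, c.dim < n)
    (hface : IsFaceClosed 𝒞) {𝒱 : ℕ → Set (Set Y)} (href : ∀ i < n, Refines (𝒱 i) (𝒱 (i + 1)))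
    (hext : ∀ i < n, ∀ j < n, HomotopyExtension j f (𝒱 i) (𝒱 (i + 1))) {α β : (V → ℝ) → X}
    (hα : ∀ c ∈ 𝒞, ContinuousOn α c.carrier) (hβ : ∀ c ∈ 𝒞, ContinuousOn β c.carrier)
    (hαβ : ∀ c ∈ 𝒞, ∀ x ∈ c.carrier, ∃ V ∈ 𝒱 0, f (α x) ∈ V ∧ f (β x) ∈ V) :
    ∃ γ : (V → ℝ) → C(I, X), ∀ c ∈ 𝒞, IsPathFamilyOn c.carrier α β γ ∧
      ∀ x ∈ c.carrier, ∃ U ∈ 𝒱 n, ∀ r, f (γ x r) ∈ U := by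
  have hrefines : ∀ {i j}, i ≤ j → j ≤ n → Refines (𝒱 i) (𝒱 j) := by
    intro i j hij
    induction j, hij using Nat.le_induction with
    | base => exact fun _ V hV => ⟨V, hV, subset_rfl⟩
    | succ j _ ih =>
      intro hj V hV
      obtain ⟨V', hV', hVV'⟩ := ih (Nat.le_of_succ_le hj) V hV
      obtain ⟨U, hU, hV'U⟩ := href j hj V' hV'
      exact ⟨U, hU, hVV'.trans hV'U⟩
  have : Nonempty C(I, X) := ⟨ContinuousMap.const I (α 0)⟩
  suffices ∃ γ : (V → ℝ) → C(I, X), ∀ c ∈ 𝒞, IsPathFamilyOn c.carrier α β γ ∧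
      ∀ x ∈ c.carrier, ∃ U ∈ 𝒱 (c.dim + 1), ∀ r, f (γ x r) ∈ U by
    obtain ⟨γ, hγ⟩ := this
    refine ⟨γ, fun c hc => ⟨(hγ c hc).1, fun x hx => ?_⟩⟩
    obtain ⟨V, hV, hr⟩ := (hγ c hc).2 x hx
    obtain ⟨U, hU, hVU⟩ := hrefines (hdim c hc) le_rfl V hV
    exact ⟨U, hU, fun r => hVU (hr r)⟩
  refine exists_forall_of_extension hdim hface _ (fun c _ h h' heq hh =>
    ⟨hh.1.congr heq, fun x hx => heq hx ▸ hh.2 x hx⟩) fun c hc h hh => ?_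
  have hbdry : IsPathFamilyOn c.bdry α β h := by
    refine ⟨continuousOn_bdry fun c' hc' hlt => (hh c' hc' hlt).1.continuousOn, ?_, ?_⟩ <;>
      intro x hx <;> obtain ⟨c', hxc', hc', hlt⟩ := exists_face_of_mem_bdry hx
    · exact (hh c' hc' hlt).1.source x hxc'
    · exact (hh c' hc' hlt).1.target x hxc'
  refine c.exists_controlled_paths (hext _ (hdim c hc) _ (hdim c hc)) (hα c hc) (hβ c hc)
    (fun x hx => ?_) hbdry fun x hx => ?_
  · obtain ⟨V, hV, hαV, hβV⟩ := hαβ c hc x hx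
    obtain ⟨U, hU, hVU⟩ := hrefines (Nat.zero_le c.dim) (hdim c hc).le V hV
    exact ⟨U, hU, hVU hαV, hVU hβV⟩
  · obtain ⟨c', hxc', hc', hlt⟩ := exists_face_of_mem_bdry hx
    obtain ⟨V, hV, hr⟩ := (hh c' hc' hlt).2 x hxc'
    obtain ⟨U, hU, hVU⟩ := hrefines hlt (hdim c hc).le V hV
    exact ⟨U, hU, fun r => hVU (hr r)⟩

end Cell

namespace Polyhedron

variable {V : Type w} {K : PreAbstractSimplicialComplex V} {X : Type u} [TopologicalSpace X]

theorem continuous_incl (s : K.faces) : Continuous (incl K s) :=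
  continuous_iff_coinduced_le.2 (le_iSup (fun s : K.faces =>
    TopologicalSpace.coinduced (incl K s) inferInstance) s)

theorem continuous_of_incl {g : Polyhedron K → X} (h : ∀ s, Continuous (g ∘ incl K s)) :
    Continuous g :=
  continuous_iSup_dom.2 fun s => continuous_coinduced_dom.2 (h s)

/-- A map of `|K|` in the coordinates in which the simplexes of `K` are unions of boxes. Outside of
`|K|` its values are arbitrary. -/
noncomputable def cubicalMap [Nonempty X] (Φ : C(Polyhedron K, X)) (x : V → ℝ) : X :=
  Function.extend (fun p : Polyhedron K => p.1) Φ (fun _ => Classical.arbitrary X) (sumNormalize x)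

theorem cubicalMap_eq [Nonempty X] (Φ : C(Polyhedron K, X)) {x : V → ℝ} {p : Polyhedron K}
    (h : sumNormalize x = p.1) : cubicalMap Φ x = Φ p := by
  rw [cubicalMap, h]
  exact Subtype.val_injective.extend_apply _ _ p

theorem continuousOn_cubicalMap [Nonempty X] (Φ : C(Polyhedron K, X)) {b : Finset V}
    (hb : b ∈ K.faces) : ContinuousOn (cubicalMap Φ) (maxSimplex b) := by
  let e : maxSimplex b → closedSimplex b := fun x => ⟨sumNormalize x.1, sumNormalize_mem x.2⟩
  have he : Continuous e := continuousOn_sumNormalize.domRestrict.subtype_mk _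
  rw [continuousOn_iff_continuous_domRestrict]
  refine (Φ.continuous.comp ((continuous_incl ⟨b, hb⟩).comp he)).congr fun x => ?_
  exact (cubicalMap_eq Φ rfl).symm

theorem sumNormalize_maxNormalize (p : Polyhedron K) :
    sumNormalize (maxNormalize p.1) = p.1 := by
  obtain ⟨x, s, hs, hx⟩ := p
  exact FineHomotopy.sumNormalize_maxNormalize (K.isRelLowerSet_faces hs).1 hx

theorem homotopicWithin_of_cubicalCells [Nonempty X] {Φ Ψ : C(Polyhedron K, X)}
    {𝒰 : Set (Set X)} {γ : (V → ℝ) → C(I, X)}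
    (hγ : ∀ c ∈ cubicalCells K.faces, IsPathFamilyOn c.carrier (cubicalMap Φ) (cubicalMap Ψ) γ ∧
      ∀ x ∈ c.carrier, ∃ U ∈ 𝒰, ∀ r, γ x r ∈ U) : HomotopicWithin 𝒰 Φ Ψ := by
  have hne : ∀ s ∈ K.faces, s.Nonempty := fun s hs => (K.isRelLowerSet_faces hs).1
  have hcell : ∀ p : Polyhedron K, ∃ c ∈ cubicalCells K.faces, maxNormalize p.1 ∈ c.carrier := by
    rintro ⟨x, s, hs, hx⟩
    exact exists_mem_cubicalCells hs (maxNormalize_mem (hne s hs) hx)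
  have hcont : Continuous fun p : Polyhedron K => γ (maxNormalize p.1) := by
    refine continuous_of_incl fun s => ?_
    exact ((continuousOn_maxSimplex (fun c hc => (hγ c hc).1.continuousOn) s.2).comp
      (continuousOn_maxNormalize (hne s s.2)) fun x hx =>
        maxNormalize_mem (hne s s.2) hx).comp_continuous continuous_subtype_val fun x => x.2
  refine ⟨⟨⟨fun q => γ (maxNormalize q.2.1) q.1,
    continuous_eval.comp ((hcont.comp continuous_snd).prodMk continuous_fst)⟩,
    fun p => ?_, fun p => ?_⟩, fun p => ?_⟩ <;> obtain ⟨c, hc, hp⟩ := hcell p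
  · exact ((hγ c hc).1.source _ hp).trans (cubicalMap_eq Φ (sumNormalize_maxNormalize p))
  · exact ((hγ c hc).1.target _ hp).trans (cubicalMap_eq Ψ (sumNormalize_maxNormalize p))
  · exact (hγ c hc).2 _ hp

end Polyhedron

theorem HasLocalExtensions.exists_homotopicWithin {n : ℕ} {X : Type u} {Y : Type v}
    [TopologicalSpace X] [PseudoMetricSpace Y] {f : X → Y} (hf : HasLocalExtensions n f)
    (hfc : Continuous f) {𝒰 : Set (Set Y)} (h𝒰 : IsOpenCovering 𝒰) :
    ∃ 𝒱 : Set (Set Y), IsOpenCovering 𝒱 ∧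
      ∀ (V : Type w) (K : PreAbstractSimplicialComplex V), ComplexDimLT K n →
        ∀ Φ Ψ : C(Polyhedron K, X), (∀ p, ∃ V ∈ 𝒱, f (Φ p) ∈ V ∧ f (Ψ p) ∈ V) →
          HomotopicWithin (preimageFamily f 𝒰) Φ Ψ := by
  obtain ⟨𝒱, rfl, hcov, hnext⟩ :=
    exists_seq_of_forall_exists (fun _ => hf.exists_homotopyExtension hfc) n h𝒰
  refine ⟨𝒱 0, hcov 0, fun V K hK Φ Ψ hΦΨ => ?_⟩
  rcases isEmpty_or_nonempty X with _ | _
  · obtain rfl : Φ = Ψ := ContinuousMap.ext fun p => isEmptyElim (Φ p)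
    exact ⟨ContinuousMap.Homotopy.refl Φ, fun p => isEmptyElim (Φ p)⟩
  have hcont : ∀ Φ : C(Polyhedron K, X), ∀ c ∈ cubicalCells K.faces,
      ContinuousOn (Polyhedron.cubicalMap Φ) c.carrier := fun Φ _ ⟨_, hb, hcb⟩ =>
    (Polyhedron.continuousOn_cubicalMap Φ hb).mono hcb
  obtain ⟨γ, hγ⟩ := Cell.exists_controlled_homotopy (𝒞 := cubicalCells K.faces)
    (fun _ ⟨b, hb, hcb⟩ => (Cell.dim_lt_card hcb).trans_le (hK b hb))
    (isFaceClosed_cubicalCells K.faces) (fun i hi => (hnext i hi).1) (fun i hi => (hnext i hi).2)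
    (hcont Φ) (hcont Ψ) fun _ ⟨b, hb, hcb⟩ x hx => by
      let p : Polyhedron K := ⟨sumNormalize x, b, hb, sumNormalize_mem (hcb hx)⟩
      simpa only [Polyhedron.cubicalMap_eq (p := p) _ rfl] using hΦΨ p
  refine Polyhedron.homotopicWithin_of_cubicalCells fun c hc => ⟨(hγ c hc).1, fun x hx => ?_⟩
  obtain ⟨U, hU, hr⟩ := (hγ c hc).2 x hx
  exact ⟨f ⁻¹' U, mem_image_of_mem _ hU, hr⟩

/-! ### Approximate right inverses -/

section Nerve

variable {ι : Type w} {Y : Type v} {N : ι → Set Y}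

/-- The nerve of a family of sets, as the set of its finite simplexes. -/
def coverNerve (N : ι → Set Y) : Set (Finset ι) :=
  {b | (⋂ i ∈ b, N i).Nonempty}

theorem card_le_of_mem_coverNerve {𝒩 : Set (Set Y)} {m : ℕ}
    (hord : ∀ y, {V ∈ 𝒩 | y ∈ V}.encard ≤ m) {b : Finset 𝒩}
    (hb : b ∈ coverNerve (Subtype.val : 𝒩 → Set Y)) : b.card ≤ m := by
  obtain ⟨y, hy⟩ := hb
  have hsub : (Subtype.val '' (b : Set 𝒩)) ⊆ {V ∈ 𝒩 | y ∈ V} := by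
    rintro _ ⟨i, hi, rfl⟩
    exact ⟨i.2, mem_iInter₂.1 hy i hi⟩
  have := (encard_le_encard hsub).trans (hord y)
  rw [Subtype.val_injective.encard_image, encard_coe_eq_coe_finsetCard] at this
  exact_mod_cast this

/-- The intersection of the members of `N` whose coordinates are equal to `1` on the box `c`. It
decreases with `c`, while the intersection over the whole simplex that contains `c` increases. -/
def cellCore (N : ι → Set Y) (c : Cell ι) : Set Y :=
  {y | ∀ i, c.base i = 1 → y ∈ N i}

theorem base_eq_one_of_subset {b : Finset ι} {c c' : Cell ι} (hcb : c.carrier ⊆ maxSimplex b)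
    (hcc' : c'.carrier ⊆ c.carrier) {i : ι} (hi : c.base i = 1) : c'.base i = 1 := by
  have hmem := hcc' c'.base_mem_carrier
  have hge : (c.base i : ℝ) ≤ c'.base i := (hmem i).1
  have hle : (c'.base i : ℝ) ≤ 1 := ((hcb hmem).1 i).2
  rw [hi] at hge
  exact le_antisymm (by exact_mod_cast hle) (by exact_mod_cast hge)

theorem cellCore_mono {b : Finset ι} {c c' : Cell ι} (hcb : c.carrier ⊆ maxSimplex b)
    (hcc' : c'.carrier ⊆ c.carrier) : cellCore N c' ⊆ cellCore N c :=
  fun _ hy i hi => hy i (base_eq_one_of_subset hcb hcc' hi)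

theorem mem_of_base_eq_one {b : Finset ι} {c : Cell ι} (hcb : c.carrier ⊆ maxSimplex b) {i : ι}
    (hi : c.base i = 1) : i ∈ b := by
  by_contra hib
  have := (hcb c.base_mem_carrier).2.1 i hib
  simp [hi] at this

theorem isOpen_cellCore [TopologicalSpace Y] (hN : ∀ i, IsOpen (N i)) {b : Finset ι} {c : Cell ι}
    (hcb : c.carrier ⊆ maxSimplex b) : IsOpen (cellCore N c) := by
  have hfin : {i | c.base i = 1}.Finite :=
    b.finite_toSet.subset fun _ hi => mem_of_base_eq_one hcb hi
  have heq : cellCore N c = ⋂ i ∈ {i | c.base i = 1}, N i := by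
    ext y
    simp only [cellCore, mem_ofPred_eq, mem_iInter₂]
  exact heq ▸ hfin.isOpen_biInter fun i _ => hN i

theorem nonempty_cellCore {c : Cell ι} (hc : c ∈ cubicalCells (coverNerve N)) :
    (cellCore N c).Nonempty := by
  obtain ⟨b, ⟨y, hy⟩, hcb⟩ := hc
  exact ⟨y, fun i hi => mem_iInter₂.1 hy i (mem_of_base_eq_one hcb hi)⟩

theorem exists_cellCore_subset {c : Cell ι} (hc : c ∈ cubicalCells (coverNerve N)) :
    ∃ i, cellCore N c ⊆ N i := by
  obtain ⟨b, -, hcb⟩ := hc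
  obtain ⟨-, i, -, -, hi⟩ := Cell.dirs_subset_and_exists_base_eq_one hcb
  exact ⟨i, fun _ hy => hy i hi⟩

end Nerve

section NerveMap

variable {ι : Type w} {Y : Type v} [TopologicalSpace Y] (n : ℕ) (ρ : PartitionOfUnity ι Y)

/-- The canonical map of `Y` into the nerve, with values in the union of the sets `maxSimplex b`. If
at most `n + 1` functions `ρ i` are nonzero at `y`, one of them is at least `1 / (n + 1)` there. -/
noncomputable def nerveMap (y : Y) (i : ι) : ℝ := min 1 ((n + 1) * ρ i y)

theorem continuous_nerveMap : Continuous (nerveMap n ρ) :=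
  continuous_pi fun i => continuous_const.min (continuous_const.mul (ρ i).continuous)

variable {n ρ}

theorem nerveMap_mem_maxSimplex {y : Y} (hcard : (ρ.finsupport y).card ≤ n + 1) :
    nerveMap n ρ y ∈ maxSimplex (ρ.finsupport y) := by
  have hsum : ∑ i ∈ ρ.finsupport y, ρ i y = 1 := ρ.sum_finsupport (mem_univ y)
  have hn : (0 : ℝ) < n + 1 := by positivity
  refine ⟨fun i => ⟨le_min zero_le_one (mul_nonneg hn.le (ρ.nonneg i y)), min_le_left _ _⟩,
    fun i hi => ?_, ?_⟩
  · have : ρ i y = 0 := by simpa using hi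
    simp [nerveMap, this]
  · have hne : (ρ.finsupport y).Nonempty := by
      by_contra! h
      simp [h] at hsum
    obtain ⟨i, hi, hle⟩ : ∃ i ∈ ρ.finsupport y, 1 / (n + 1 : ℝ) ≤ ρ i y := by
      refine Finset.exists_le_of_sum_le hne ?_
      rw [hsum, Finset.sum_const, nsmul_eq_mul, mul_one_div, div_le_one hn]
      exact_mod_cast hcard
    exact ⟨i, hi, min_eq_left ((div_le_iff₀' hn).1 hle)⟩

theorem continuous_comp_nerveMap {X : Type u} [TopologicalSpace X] {𝒦 : Set (Finset ι)}
    (h𝒦 : ∀ y, ρ.finsupport y ∈ 𝒦) (hcard : ∀ b ∈ 𝒦, b.card ≤ n + 1) {h : (ι → ℝ) → X}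
    (hh : ∀ c ∈ cubicalCells 𝒦, ContinuousOn h c.carrier) : Continuous (h ∘ nerveMap n ρ) := by
  refine continuous_iff_continuousAt.2 fun y => ?_
  obtain ⟨O, hO, hfin⟩ := ρ.locallyFinite y
  let 𝒦' : Set (Finset ι) := {b | b ∈ 𝒦 ∧ b ⊆ hfin.toFinset}
  have : Finite 𝒦' := (hfin.toFinset.powerset.finite_toSet.subset fun b hb =>
    Finset.mem_coe.2 (Finset.mem_powerset.2 hb.2)).to_subtype
  have hcont : ContinuousOn h (⋃ b : 𝒦', maxSimplex b.1) :=
    (locallyFinite_of_finite _).continuousOn_iUnion (fun _ => isClosed_maxSimplex _)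
      fun b => continuousOn_maxSimplex hh b.2.1
  have hmaps : MapsTo (nerveMap n ρ) O (⋃ b : 𝒦', maxSimplex b.1) := by
    intro z hz
    refine mem_iUnion.2 ⟨⟨ρ.finsupport z, h𝒦 z, fun i hi => ?_⟩,
      nerveMap_mem_maxSimplex (hcard _ (h𝒦 z))⟩
    exact hfin.mem_toFinset.2 ⟨z, (ρ.mem_finsupport z).1 hi, hz⟩
  exact (hcont.comp (continuous_nerveMap n ρ).continuousOn hmaps).continuousAt hO

theorem mem_cellCore_of_nerveMap_mem {N : ι → Set Y} (hρ : ρ.IsSubordinate N) {y : Y} {c : Cell ι}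
    (hc : nerveMap n ρ y ∈ c.carrier) : y ∈ cellCore N c := by
  intro i hi
  refine hρ i (subset_tsupport _ fun h0 => ?_)
  have := (hc i).1
  norm_num [hi, nerveMap, h0] at this

theorem finsupport_mem_coverNerve {N : ι → Set Y} (hρ : ρ.IsSubordinate N) (y : Y) :
    ρ.finsupport y ∈ coverNerve N :=
  ⟨y, mem_iInter₂.2 fun i hi => hρ i (subset_tsupport _ ((ρ.mem_finsupport y).1 hi))⟩

end NerveMap

theorem IsExtensionSystem.exists_map_of_coverNerve {ι : Type w} {n : ℕ} {X : Type u} {Y : Type v}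
    [TopologicalSpace X] [Nonempty X] [TopologicalSpace Y] {f : X → Y} {𝒱 𝒰 : Set (Set Y)}
    {S : Set Y → ℕ → Set X} (hS : IsExtensionSystem n f 𝒱 𝒰 S) (hfd : DenseRange f)
    {N : ι → Set Y} (hNo : ∀ i, IsOpen (N i)) (hN𝒱 : ∀ i, ∃ V ∈ 𝒱, N i ⊆ V)
    (hcard : ∀ b ∈ coverNerve N, b.card ≤ n + 1) :
    ∃ h : (ι → ℝ) → X, ∀ c ∈ cubicalCells (coverNerve N), ContinuousOn h c.carrier ∧
      ∃ U ∈ 𝒰, cellCore N c ⊆ U ∧ ∀ x ∈ c.carrier, f (h x) ∈ U := by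
  have hdim : ∀ c ∈ cubicalCells (coverNerve N), c.dim ≤ n := fun _ ⟨b, hb, hcb⟩ =>
    Nat.lt_succ_iff.1 ((Cell.dim_lt_card hcb).trans_le (hcard b hb))
  have hsmall : ∀ c ∈ cubicalCells (coverNerve N), ∃ V ∈ 𝒱, cellCore N c ⊆ V := by
    intro c hc
    obtain ⟨i, hi⟩ := exists_cellCore_subset hc
    obtain ⟨V, hV, hiV⟩ := hN𝒱 i
    exact ⟨V, hV, hi.trans hiV⟩
  have hne : ∀ c ∈ cubicalCells (coverNerve N), (f ⁻¹' cellCore N c).Nonempty := by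
    rintro c ⟨b, hb, hcb⟩
    exact hfd.exists_mem_open (isOpen_cellCore hNo hcb) (nonempty_cellCore ⟨b, hb, hcb⟩)
  have hchain : ∀ c ∈ cubicalCells (coverNerve N), IsExtensionChain n (S (cellCore N c)) := by
    intro c hc
    obtain ⟨V, hV, hcV⟩ := hsmall c hc
    exact hS.chain hV hcV (hne c hc)
  obtain ⟨h, hh⟩ := Cell.exists_carried_map (T := fun c => S (cellCore N c)) hdim
    (isFaceClosed_cubicalCells _) (fun _ ⟨_, _, hcb⟩ _ hcc' => hS.mono (cellCore_mono hcb hcc'))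
    hchain fun c hc => by
      obtain ⟨V, hV, hcV⟩ := hsmall c hc
      exact (hne c hc).mono (hS.preimage_subset hV hcV (hne c hc))
  refine ⟨h, fun c hc => ⟨(hh c hc).1, ?_⟩⟩
  obtain ⟨V, hV, hcV⟩ := hsmall c hc
  obtain ⟨U, hU, hcU, hSU⟩ := hS.exists_subset hV hcV (hne c hc)
  exact ⟨U, hU, hcU, fun x hx =>
    hSU ((hchain c hc).subset (hdim c hc) le_rfl ((hh c hc).2 x hx))⟩

theorem exists_approximate_rightInverse {n : ℕ} {X : Type u} {Y : Type v} [TopologicalSpace X]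
    [PseudoMetricSpace Y] (hdim : DimLE n Y) {f : X → Y} (hf : HasLocalExtensions n f)
    (hfd : DenseRange f) {𝒰 : Set (Set Y)} (h𝒰 : IsOpenCovering 𝒰) :
    ∃ g : C(Y, X), ∀ y, ∃ U ∈ 𝒰, f (g y) ∈ U ∧ y ∈ U := by
  rcases isEmpty_or_nonempty Y with hY | hY
  · exact ⟨⟨isEmptyElim, continuous_of_const fun y => isEmptyElim y⟩, isEmptyElim⟩
  have : Nonempty X := hfd.nonempty_iff.2 hY
  obtain ⟨𝒱, S, h𝒱, hS⟩ := hf.exists_extensionSystem h𝒰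
  obtain ⟨𝒩, ⟨h𝒩o, h𝒩⟩, h𝒩𝒱, hord⟩ := hdim 𝒱 h𝒱
  let N : 𝒩 → Set Y := Subtype.val
  have hNo : ∀ i, IsOpen (N i) := fun i => h𝒩o i i.2
  obtain ⟨ρ, hρ⟩ := PartitionOfUnity.exists_isSubordinate isClosed_univ N hNo
    (by rw [← sUnion_eq_iUnion, h𝒩])
  have hcard : ∀ b ∈ coverNerve N, b.card ≤ n + 1 := fun b hb => card_le_of_mem_coverNerve hord hb
  have hρN := finsupport_mem_coverNerve hρ
  obtain ⟨h, hh⟩ := hS.exists_map_of_coverNerve hfd hNo (fun i => h𝒩𝒱 i i.2) hcard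
  refine ⟨⟨h ∘ nerveMap n ρ, continuous_comp_nerveMap hρN hcard fun c hc => (hh c hc).1⟩,
    fun y => ?_⟩
  obtain ⟨c, hc, hyc⟩ := exists_mem_cubicalCells (hρN y)
    (nerveMap_mem_maxSimplex (hcard _ (hρN y)))
  obtain ⟨-, U, hU, hcU, hhU⟩ := hh c hc
  exact ⟨U, hU, hhU _ hyc, hcU (mem_cellCore_of_nerveMap_mem hρ hyc)⟩

/-! ### From homotopy groups to extensions over cubes -/

section Wrap

variable {E : Type*} [NormedAddCommGroup E] [NormedSpace ℝ E]

/-- A map of the unit ball that, after normalization, wraps the ball around the unit sphere of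
`ℝ × E`: the center goes to the north pole and the whole boundary to the south pole. -/
noncomputable def wrap (x : E) : ℝ × E := (1 - 2 * ‖x‖, (1 - ‖x‖) • x)

theorem continuous_wrap : Continuous (wrap (E := E)) := by
  unfold wrap
  fun_prop

theorem wrap_of_norm_eq_one {x : E} (hx : ‖x‖ = 1) : wrap x = (-1, 0) := by
  norm_num [wrap, hx]

theorem wrap_ne_zero (x : E) : wrap x ≠ 0 := by
  intro h
  have hr : ‖x‖ = 1 / 2 := by linarith [congrArg Prod.fst h, show (wrap x).1 = 1 - 2 * ‖x‖ from rfl,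
    show (0 : ℝ × E).1 = 0 from rfl]
  have hx : (1 - ‖x‖) • x = 0 := congrArg Prod.snd h
  rcases smul_eq_zero.1 hx with h0 | rfl
  · linarith
  · norm_num at hr

theorem eq_and_eq_one_of_wrap_radius {r s a : ℝ} (hr : r ∈ Icc (0 : ℝ) 1) (hs : s ∈ Icc (0 : ℝ) 1)
    (ha : 0 < a) (h₁ : 1 - 2 * r = a * (1 - 2 * s)) (h₂ : (1 - r) * r = a * ((1 - s) * s)) :
    r = s ∧ a = 1 := by
  have hprod : a * ((s - r) * ((1 - r) * (1 - s) + r * s)) = 0 := by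
    linear_combination (1 - s) * s * a * h₁ - (1 - 2 * s) * a * h₂
  have hr' := sub_nonneg.2 hr.2
  have hs' := sub_nonneg.2 hs.2
  have hrs : r = s := by
    rcases mul_eq_zero.1 ((mul_eq_zero.1 hprod).resolve_left ha.ne') with h | h
    · linarith
    · obtain ⟨h', h⟩ := (add_eq_zero_iff_of_nonneg (mul_nonneg hr' hs') (mul_nonneg hr.1 hs.1)).1 h
      rcases mul_eq_zero.1 h with rfl | rfl <;> nlinarith
  refine ⟨hrs, ?_⟩
  subst hrs
  by_contra hne
  have h : ∀ b, b = a * b → b = 0 := fun b hb =>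
    (mul_eq_zero.1 (by linear_combination -hb : (a - 1) * b = 0)).resolve_left (sub_ne_zero.2 hne)
  rcases mul_eq_zero.1 (h _ h₂) with h' | h' <;> linarith [h _ h₁]

theorem eq_or_of_wrap_eq_smul {x z : E} (hx : ‖x‖ ≤ 1) (hz : ‖z‖ ≤ 1) {a : ℝ} (ha : 0 < a)
    (h : wrap x = a • wrap z) : x = z ∨ (‖x‖ = 1 ∧ ‖z‖ = 1) := by
  have h₁ : 1 - 2 * ‖x‖ = a * (1 - 2 * ‖z‖) := congrArg Prod.fst h
  have h₂ : (1 - ‖x‖) • x = a • (1 - ‖z‖) • z := congrArg Prod.snd h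
  have hnorm := congrArg norm h₂
  rw [norm_smul, norm_smul, norm_smul, Real.norm_of_nonneg (sub_nonneg.2 hx),
    Real.norm_of_nonneg ha.le, Real.norm_of_nonneg (sub_nonneg.2 hz)] at hnorm
  obtain ⟨hxz, rfl⟩ := eq_and_eq_one_of_wrap_radius ⟨norm_nonneg x, hx⟩ ⟨norm_nonneg z, hz⟩ ha
    h₁ hnorm
  by_cases hx1 : ‖x‖ = 1
  · exact Or.inr ⟨hx1, hxz ▸ hx1⟩
  · rw [one_smul, ← hxz] at h₂
    exact Or.inl (smul_right_injective _ (sub_ne_zero.2 (Ne.symm hx1)) h₂)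

theorem exists_wrap_radius {ζ : ℝ} (hζ : 0 < ζ) (τ : ℝ) :
    ∃ r ∈ Ioo (0 : ℝ) 1, (1 - 2 * r) * ζ = τ * ((1 - r) * r) := by
  have hcont : ContinuousOn (fun r : ℝ => (1 - 2 * r) * ζ - τ * ((1 - r) * r)) (Icc 0 1) := by
    fun_prop
  obtain ⟨r, hr, h⟩ := intermediate_value_Ioo' zero_le_one hcont
    (show (0 : ℝ) ∈ _ by constructor <;> norm_num <;> exact hζ)
  exact ⟨r, hr, sub_eq_zero.1 h⟩

theorem exists_wrap_eq_smul_of_ne_zero (τ : ℝ) {z : E} (hz : z ≠ 0) :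
    ∃ x : E, ‖x‖ ≤ 1 ∧ ∃ a : ℝ, 0 < a ∧ wrap x = a • (τ, z) := by
  have hζ : 0 < ‖z‖ := norm_pos_iff.2 hz
  obtain ⟨r, ⟨hr, hr'⟩, h⟩ := exists_wrap_radius hζ τ
  have : 0 < 1 - r := sub_pos.2 hr'
  have hn : ‖(r / ‖z‖) • z‖ = r := by
    rw [norm_smul, Real.norm_of_nonneg (by positivity), div_mul_cancel₀ _ hζ.ne']
  refine ⟨(r / ‖z‖) • z, hn.le.trans hr'.le, (1 - r) * r / ‖z‖, by positivity, ?_⟩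
  rw [wrap, hn, Prod.smul_mk, smul_smul, mul_div_assoc, smul_eq_mul]
  refine congrArg (·, _) ?_
  field_simp
  linarith

theorem exists_wrap_eq_smul [Nontrivial E] {e : ℝ × E} (he : ‖e‖ = 1) :
    ∃ x : E, ‖x‖ ≤ 1 ∧ ∃ a : ℝ, 0 < a ∧ wrap x = a • e := by
  obtain ⟨τ, z⟩ := e
  by_cases hz : z = 0
  · have hτ : |τ| = 1 := by simpa [Prod.norm_def, hz] using he
    rcases eq_or_eq_neg_of_abs_eq hτ with hτ | hτ
    · exact ⟨0, by simp, 1, one_pos, by simp [wrap, hτ, hz]⟩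
    · obtain ⟨x, hx⟩ := exists_norm_eq E zero_le_one
      exact ⟨x, hx.le, 1, one_pos, by simp [wrap_of_norm_eq_one hx, hτ, hz]⟩
  · exact exists_wrap_eq_smul_of_ne_zero τ hz

/-- The map of the unit ball of `E` onto the unit sphere of `ℝ × E` that collapses the boundary of
the ball to a point. -/
noncomputable def wrapSphere (x : E) : ℝ × E := ‖wrap x‖⁻¹ • wrap x

theorem continuous_wrapSphere : Continuous (wrapSphere (E := E)) :=
  (continuous_wrap.norm.inv₀ fun x => norm_ne_zero_iff.2 (wrap_ne_zero x)).smul continuous_wrap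

theorem norm_wrapSphere (x : E) : ‖wrapSphere x‖ = 1 := by
  rw [wrapSphere, norm_smul, norm_inv, norm_norm]
  exact inv_mul_cancel₀ (norm_ne_zero_iff.2 (wrap_ne_zero x))

theorem wrapSphere_eq_of_norm_eq_one {x x' : E} (hx : ‖x‖ = 1) (hx' : ‖x'‖ = 1) :
    wrapSphere x = wrapSphere x' := by
  rw [wrapSphere, wrapSphere, wrap_of_norm_eq_one hx, wrap_of_norm_eq_one hx']

theorem eq_or_of_wrapSphere_eq {x z : E} (hx : ‖x‖ ≤ 1) (hz : ‖z‖ ≤ 1)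
    (h : wrapSphere x = wrapSphere z) : x = z ∨ (‖x‖ = 1 ∧ ‖z‖ = 1) := by
  have hpos : ∀ y : E, 0 < ‖wrap y‖ := fun y => norm_pos_iff.2 (wrap_ne_zero y)
  refine eq_or_of_wrap_eq_smul hx hz (a := ‖wrap x‖ * ‖wrap z‖⁻¹)
    (mul_pos (hpos x) (inv_pos.2 (hpos z))) ?_
  rw [mul_smul, ← wrapSphere.eq_def z, ← h, wrapSphere, smul_inv_smul₀ (hpos x).ne']

theorem exists_wrapSphere_eq [Nontrivial E] {e : ℝ × E} (he : ‖e‖ = 1) :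
    ∃ x : E, ‖x‖ ≤ 1 ∧ wrapSphere x = e := by
  obtain ⟨x, hx, a, ha, h⟩ := exists_wrap_eq_smul he
  refine ⟨x, hx, ?_⟩
  rw [wrapSphere, h, norm_smul, he, Real.norm_of_nonneg ha.le, mul_one, inv_smul_smul₀ ha.ne']

end Wrap

section WrapCube

variable {m k : ℕ}

/-- The affine map of the standard cube onto the unit ball of the supremum norm. -/
def center (t : Fin m → I) : Fin m → ℝ := fun i => 2 * (t i : ℝ) - 1

/-- The inverse of `center`, extended by clamping. -/
noncomputable def uncenter (x : Fin m → ℝ) : Fin m → I :=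
  fun i => projIcc 0 1 zero_le_one ((x i + 1) / 2)

theorem continuous_center : Continuous (center (m := m)) := by
  unfold center
  fun_prop

theorem continuous_uncenter : Continuous (uncenter (m := m)) :=
  continuous_pi fun _ => continuous_projIcc.comp (by fun_prop)

theorem uncenter_center (t : Fin m → I) : uncenter (center t) = t := by
  funext i
  simp [uncenter, center]

theorem center_uncenter {x : Fin m → ℝ} (hx : ‖x‖ ≤ 1) : center (uncenter x) = x := by
  funext i
  have h := abs_le.1 ((norm_le_pi_norm x i).trans hx)
  have hi : (x i + 1) / 2 ∈ Icc (0 : ℝ) 1 := ⟨by linarith, by linarith⟩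
  simp only [center, uncenter, projIcc_of_mem zero_le_one hi]
  ring

theorem norm_center_le (t : Fin m → I) : ‖center t‖ ≤ 1 := by
  refine (pi_norm_le_iff_of_nonneg zero_le_one).2 fun i => ?_
  rw [Real.norm_eq_abs, abs_le]
  constructor <;> simp only [center] <;> linarith [(t i).2.1, (t i).2.2]

theorem norm_center_eq_one_iff {t : Fin m → I} : ‖center t‖ = 1 ↔ t ∈ Cube.boundary (Fin m) := by
  refine ⟨fun h => ?_, fun ⟨i, hi⟩ => le_antisymm (norm_center_le t) ?_⟩
  · by_contra hb
    refine h.not_lt ((pi_norm_lt_iff one_pos).2 fun i => ?_)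
    have h₀ : (0 : ℝ) < t i := unitInterval.pos_iff_ne_zero.2 fun h => hb ⟨i, Or.inl h⟩
    have h₁ : (t i : ℝ) < 1 := unitInterval.lt_one_iff_ne_one.2 fun h => hb ⟨i, Or.inr h⟩
    rw [Real.norm_eq_abs, abs_lt]
    constructor <;> simp only [center] <;> linarith
  · refine le_trans ?_ (norm_le_pi_norm (center t) i)
    rcases hi with hi | hi <;> norm_num [center, hi]

theorem norm_finConsEquivL (p : ℝ × (Fin k → ℝ)) :
    ‖Fin.consEquivL ℝ (fun _ => ℝ) p‖ = ‖p‖ := by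
  refine le_antisymm ((pi_norm_le_iff_of_nonneg (norm_nonneg p)).2 (Fin.cases ?_ fun i => ?_))
    (max_le ?_ ((pi_norm_le_iff_of_nonneg (norm_nonneg _)).2 fun i => ?_))
  · exact norm_le_pi_norm (Fin.consEquivL ℝ (fun _ => ℝ) p) 0
  · exact norm_le_pi_norm (Fin.consEquivL ℝ (fun _ => ℝ) p) i.succ
  · exact norm_fst_le p
  · exact (norm_le_pi_norm p.2 i).trans (norm_snd_le p)

/-- The map of `I × I^k` onto `I^(k + 1)` that wraps the cubes `{r} × I^k` around concentric
spheres. It identifies `I^(k + 1)` with the quotient of `I × I^k` by `{1} × I^k` and the sets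
`{r} × ∂I^k`. -/
noncomputable def wrapCube (p : I × (Fin k → I)) : Fin (k + 1) → I :=
  uncenter (Fin.consEquivL ℝ (fun _ => ℝ) ((1 - (p.1 : ℝ)) • wrapSphere (center p.2)))

theorem continuous_wrapCube : Continuous (wrapCube (k := k)) :=
  continuous_uncenter.comp ((Fin.consEquivL ℝ fun _ => ℝ).continuous.comp
    ((by fun_prop : Continuous fun p : I × (Fin k → I) => 1 - (p.1 : ℝ)).smul
      (continuous_wrapSphere.comp (continuous_center.comp continuous_snd))))

theorem norm_smul_wrapSphere_center (p : I × (Fin k → I)) :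
    ‖Fin.consEquivL ℝ (fun _ => ℝ) ((1 - (p.1 : ℝ)) • wrapSphere (center p.2))‖ = 1 - p.1 := by
  rw [norm_finConsEquivL, norm_smul, norm_wrapSphere, mul_one,
    Real.norm_of_nonneg (sub_nonneg.2 p.1.2.2)]

theorem center_wrapCube (p : I × (Fin k → I)) : center (wrapCube p) =
    Fin.consEquivL ℝ (fun _ => ℝ) ((1 - (p.1 : ℝ)) • wrapSphere (center p.2)) :=
  center_uncenter ((norm_smul_wrapSphere_center p).trans_le (sub_le_self 1 p.1.2.1))

theorem norm_center_wrapCube (p : I × (Fin k → I)) : ‖center (wrapCube p)‖ = 1 - p.1 := by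
  rw [center_wrapCube, norm_smul_wrapSphere_center]

theorem wrapCube_mem_boundary_iff {p : I × (Fin k → I)} :
    wrapCube p ∈ Cube.boundary (Fin (k + 1)) ↔ p.1 = 0 := by
  rw [← norm_center_eq_one_iff, norm_center_wrapCube, sub_eq_self, Icc.coe_eq_zero]

theorem wrapCube_eq_of_mem_boundary (r : I) {t t' : Fin k → I} (ht : t ∈ Cube.boundary (Fin k))
    (ht' : t' ∈ Cube.boundary (Fin k)) : wrapCube (r, t) = wrapCube (r, t') := by
  simp only [wrapCube, wrapSphere_eq_of_norm_eq_one (norm_center_eq_one_iff.2 ht)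
    (norm_center_eq_one_iff.2 ht')]

theorem surjective_wrapCube (hk : 0 < k) : Function.Surjective (wrapCube (k := k)) := by
  have : Nonempty (Fin k) := ⟨⟨0, hk⟩⟩
  intro t
  obtain ⟨e, he⟩ := (Fin.consEquivL ℝ fun _ : Fin (k + 1) => ℝ).surjective (center t)
  have hnorm : ‖e‖ ≤ 1 := by
    rw [← norm_finConsEquivL, he]
    exact norm_center_le t
  suffices ∃ x, ‖x‖ ≤ 1 ∧ ‖e‖ • wrapSphere x = e by
    obtain ⟨x, hx, hxe⟩ := this
    refine ⟨(⟨1 - ‖e‖, sub_nonneg.2 hnorm, sub_le_self 1 (norm_nonneg e)⟩, uncenter x), ?_⟩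
    simp only [wrapCube, center_uncenter hx, sub_sub_cancel, hxe]
    exact (congrArg uncenter he).trans (uncenter_center t)
  rcases eq_or_ne e 0 with rfl | he0
  · exact ⟨0, by simp, by simp⟩
  · obtain ⟨x, hx, hxe⟩ := exists_wrapSphere_eq (norm_smul_inv_norm (𝕜 := ℝ) he0)
    exact ⟨x, hx, by rw [hxe]; exact smul_inv_smul₀ (norm_ne_zero_iff.2 he0) e⟩

theorem eq_or_of_wrapCube_eq {p p' : I × (Fin k → I)} (h : wrapCube p = wrapCube p') :
    p.1 = p'.1 ∧ (p.1 = 1 ∨ p.2 = p'.2 ∨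
      (p.2 ∈ Cube.boundary (Fin k) ∧ p'.2 ∈ Cube.boundary (Fin k))) := by
  have h₁ : p.1 = p'.1 := by
    have := congrArg (‖center ·‖) h
    simp only [norm_center_wrapCube] at this
    exact Subtype.ext (sub_right_injective this)
  refine ⟨h₁, or_iff_not_imp_left.2 fun hp => ?_⟩
  have hp' : 1 - (p.1 : ℝ) ≠ 0 := sub_ne_zero.2 fun h => hp (Subtype.ext h.symm)
  have h₂ := congrArg center h
  rw [center_wrapCube, center_wrapCube, ← h₁, (Fin.consEquivL ℝ fun _ => ℝ).injective.eq_iff] at h₂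
  rcases eq_or_of_wrapSphere_eq (norm_center_le p.2) (norm_center_le p'.2)
    (smul_right_injective _ hp' h₂) with h | ⟨h, h'⟩
  · exact Or.inl ((Function.LeftInverse.injective uncenter_center) h)
  · exact Or.inr ⟨norm_center_eq_one_iff.1 h, norm_center_eq_one_iff.1 h'⟩

theorem exists_lift_wrapCube {Z : Type u} [TopologicalSpace Z] (hk : 0 < k) {z : Z}
    (H : C(I × (Fin k → I), Z)) (hone : ∀ t, H (1, t) = z)
    (hbdry : ∀ r, ∀ t ∈ Cube.boundary (Fin k), H (r, t) = z) :
    ∃ L : C(Fin (k + 1) → I, Z), ∀ p, L (wrapCube p) = H p := by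
  let q : C(I × (Fin k → I), Fin (k + 1) → I) := ⟨wrapCube, continuous_wrapCube⟩
  have hq : Topology.IsQuotientMap q :=
    continuous_wrapCube.isClosedMap.isQuotientMap continuous_wrapCube (surjective_wrapCube hk)
  have hfac : Function.FactorsThrough H q := by
    rintro ⟨r, t⟩ ⟨r', t'⟩ h
    obtain ⟨rfl, rfl | rfl | ⟨ht, ht'⟩⟩ := eq_or_of_wrapCube_eq h
    · rw [hone, hone]
    · rfl
    · rw [hbdry _ t ht, hbdry _ t' ht']
  exact ⟨hq.lift H hfac, fun p => DFunLike.congr_fun (hq.lift_comp H hfac) p⟩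

end WrapCube

namespace TrivialOnHomotopyBelow

variable {n k : ℕ} {X : Type u} [TopologicalSpace X] {S S' : Set X} {hSS' : S ⊆ S'}

theorem exists_nullhomotopy
    (h : TrivialOnHomotopyBelow n (⟨inclusion hSS', continuous_inclusion hSS'⟩ : C(S, S')))
    (hk : k < n) {φ : (Fin k → I) → X} (hφ : Continuous φ) (hφS : ∀ t, φ t ∈ S) {x : X}
    (hx : x ∈ S) (hb : ∀ t ∈ Cube.boundary (Fin k), φ t = x) :
    ∃ H : C(I × (Fin k → I), S'), (∀ t, (H (0, t) : X) = φ t) ∧ (∀ t, H (1, t) = ⟨x, hSS' hx⟩) ∧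
      ∀ r, ∀ t ∈ Cube.boundary (Fin k), H (r, t) = ⟨x, hSS' hx⟩ := by
  let γ : GenLoop (Fin k) S ⟨x, hx⟩ :=
    ⟨⟨fun t => ⟨φ t, hφS t⟩, hφ.subtype_mk _⟩, fun t ht => Subtype.ext (hb t ht)⟩
  obtain ⟨H⟩ : GenLoop.Homotopic _ _ := Quotient.exact (h k hk ⟨x, hx⟩ (Quotient.mk _ γ))
  refine ⟨H.toContinuousMap, fun t => congrArg Subtype.val (H.apply_zero t), H.apply_one,
    fun r t ht => (H.eq_fst r ht).trans (Subtype.ext (hb t ht))⟩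

theorem cubeExtension_one
    (h : TrivialOnHomotopyBelow n (⟨inclusion hSS', continuous_inclusion hSS'⟩ : C(S, S')))
    (hn : 0 < n) : CubeExtension 1 S S' := by
  intro φ _ hφS
  have hb : ∀ r : I, r = 0 ∨ r = 1 → (fun _ => r) ∈ Cube.boundary (Fin 1) := fun r hr => ⟨0, hr⟩
  obtain ⟨H, H0, H1, -⟩ := h.exists_nullhomotopy hn (φ := fun _ => φ fun _ => 0) continuous_const
    (fun _ => hφS _ (hb 0 (Or.inl rfl))) (hφS _ (hb 1 (Or.inr rfl))) fun _ ⟨i, _⟩ => i.elim0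
  refine ⟨fun t => H (t 0, Fin.elim0), by fun_prop, ?_, fun t => (H _).2⟩
  rintro t ⟨i, hi⟩
  have ht : t = fun _ => t 0 := funext fun j => by rw [Subsingleton.elim j 0]
  rw [Subsingleton.elim i 0] at hi
  rcases hi with hi | hi <;> rw [hi] at ht <;> simp only [hi, H0, H1, ← ht]

theorem cubeExtension
    (h : TrivialOnHomotopyBelow n (⟨inclusion hSS', continuous_inclusion hSS'⟩ : C(S, S')))
    (hk : k < n) : CubeExtension (k + 1) S S' := by
  rcases Nat.eq_zero_or_pos k with rfl | hk0
  · exact h.cubeExtension_one hk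
  intro φ hφ hφS
  have hq : ∀ t : Fin k → I, wrapCube (0, t) ∈ Cube.boundary (Fin (k + 1)) :=
    fun t => wrapCube_mem_boundary_iff.2 rfl
  have h0 : (0 : Fin k → I) ∈ Cube.boundary (Fin k) := ⟨⟨0, hk0⟩, Or.inl rfl⟩
  obtain ⟨H, H0, H1, Hb⟩ := h.exists_nullhomotopy hk
    (hφ.comp_continuous (continuous_wrapCube.comp (Continuous.prodMk_right 0)) hq)
    (fun t => hφS _ (hq t)) (hφS _ (hq 0))
    fun t ht => congrArg φ (wrapCube_eq_of_mem_boundary 0 ht h0)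
  obtain ⟨L, hL⟩ := exists_lift_wrapCube hk0 H H1 Hb
  refine ⟨fun t => L t, by fun_prop, fun t ht => ?_, fun t => (L t).2⟩
  obtain ⟨⟨r, s⟩, rfl⟩ := surjective_wrapCube hk0 t
  obtain rfl : r = 0 := wrapCube_mem_boundary_iff.1 ht
  simp only [hL, H0, Function.comp_apply]

end TrivialOnHomotopyBelow

namespace IsUVMap

variable {n : ℕ} {X : Type u} {Y : Type v} [TopologicalSpace X] [TopologicalSpace Y] {f : C(X, Y)}

theorem hasLocalExtensions (hf : IsUVMap n f) : HasLocalExtensions n f := by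
  intro 𝒰 h𝒰
  obtain ⟨-, 𝒲, h𝒲, h⟩ := hf 𝒰 h𝒰
  refine ⟨𝒲, h𝒲, fun W hW => ?_⟩
  obtain ⟨U, hU, hWU, htriv⟩ := h W hW
  exact ⟨U, hU, hWU, fun k hk => htriv.cubeExtension hk⟩

theorem denseRange [T1Space Y] (hf : IsUVMap n f) : DenseRange f := by
  intro y
  rw [mem_closure_iff]
  intro O hO hy
  have hcov : IsOpenCovering {O, {y}ᶜ} := by
    refine ⟨?_, eq_univ_of_forall fun z => ?_⟩
    · rintro U (rfl | rfl)
      exacts [hO, isOpen_compl_singleton]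
    · by_cases hz : z = y
      · exact ⟨O, Or.inl rfl, hz ▸ hy⟩
      · exact ⟨{y}ᶜ, Or.inr rfl, hz⟩
  obtain ⟨U, ⟨rfl | rfl, hU⟩, hyU⟩ : y ∈ starOf (range f) {O, {y}ᶜ} :=
    (hf _ hcov).1 ▸ mem_univ y
  · exact hU
  · exact absurd rfl hyU

end IsUVMap

/-! ### The covering dimension of a cube -/

theorem IsOpenCovering.preimageFamily {Y : Type u} {Z : Type v} [TopologicalSpace Y]
    [TopologicalSpace Z] {𝒰 : Set (Set Z)} (h𝒰 : IsOpenCovering 𝒰) {f : Y → Z}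
    (hf : Continuous f) : IsOpenCovering (preimageFamily f 𝒰) := by
  refine ⟨?_, eq_univ_of_forall fun y => ?_⟩
  · rintro _ ⟨U, hU, rfl⟩
    exact (h𝒰.1 U hU).preimage hf
  · obtain ⟨U, hU, hy⟩ := h𝒰.exists_mem (f y)
    exact ⟨f ⁻¹' U, ⟨U, hU, rfl⟩, hy⟩

namespace DimLE

variable {m n : ℕ} {Y : Type u} [TopologicalSpace Y]

theorem mono (h : m ≤ n) (hY : DimLE m Y) : DimLE n Y := by
  intro 𝒰 h𝒰
  obtain ⟨𝒱, h𝒱, h𝒱𝒰, hcard⟩ := hY 𝒰 h𝒰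
  exact ⟨𝒱, h𝒱, h𝒱𝒰, fun y => (hcard y).trans (by gcongr)⟩

theorem of_homeomorph {Z : Type v} [TopologicalSpace Z] (e : Y ≃ₜ Z) (hY : DimLE n Y) :
    DimLE n Z := by
  intro 𝒰 h𝒰
  obtain ⟨𝒱, h𝒱, h𝒱𝒰, hcard⟩ := hY (preimageFamily e 𝒰) (h𝒰.preimageFamily e.continuous)
  refine ⟨preimageFamily e.symm 𝒱, h𝒱.preimageFamily e.symm.continuous, ?_, fun z => ?_⟩
  · rintro _ ⟨V, hV, rfl⟩
    obtain ⟨_, ⟨U, hU, rfl⟩, hVU⟩ := h𝒱𝒰 V hV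
    exact ⟨U, hU, fun z hz => e.apply_symm_apply z ▸ hVU hz⟩
  · refine ((encard_le_encard ?_).trans (encard_image_le (e.symm ⁻¹' ·) _)).trans
      (hcard (e.symm z))
    rintro _ ⟨⟨V, hV, rfl⟩, hz⟩
    exact ⟨V, ⟨hV, hz⟩, rfl⟩

end DimLE

theorem encard_sep_range_le {ι : Type*} {Y : Type u} {m : ℕ} {G : ι → Set Y} {r : ι → ℕ}
    (hr : ∀ i, r i ≤ m) (hG : ∀ i j, (G i ∩ G j).Nonempty → r i = r j → i = j) (y : Y) :
    {V ∈ range G | y ∈ V}.encard ≤ m + 1 :=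
  calc {V ∈ range G | y ∈ V}.encard
    _ ≤ (G '' {i | y ∈ G i}).encard := encard_le_encard (by
      rintro _ ⟨⟨i, rfl⟩, hi⟩
      exact ⟨i, hi, rfl⟩)
    _ ≤ {i | y ∈ G i}.encard := encard_image_le G _
    _ ≤ (Finset.range (m + 1) : Set ℕ).encard :=
      encard_le_encard_of_injOn (f := r) (fun i _ => by simpa [Nat.lt_succ_iff] using hr i)
        fun i hi j hj h => hG i j ⟨y, hi, hj⟩ h
    _ = m + 1 := by rw [encard_coe_eq_coe_finsetCard, Finset.card_range, Nat.cast_add_one]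

theorem dimLE_of_forall_exists_rank {Y : Type u} [PseudoMetricSpace Y] [CompactSpace Y] {m : ℕ}
    (h : ∀ δ > 0, ∃ (ι : Type) (G : ι → Set Y) (r : ι → ℕ), (∀ i, IsOpen (G i)) ∧
      (∀ y, ∃ i, y ∈ G i) ∧ (∀ i, ∀ y ∈ G i, ∀ z ∈ G i, dist y z < δ) ∧ (∀ i, r i ≤ m) ∧
      ∀ i j, (G i ∩ G j).Nonempty → r i = r j → i = j) : DimLE m Y := by
  intro 𝒰 h𝒰
  obtain ⟨δ, hδ, hleb⟩ := lebesgue_number_lemma_of_metric_sUnion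
    (s := (univ : Set Y)) isCompact_univ h𝒰.1 h𝒰.2.ge
  obtain ⟨ι, G, r, hopen, hcov, hdiam, hr, hG⟩ := h δ hδ
  refine ⟨{V ∈ range G | V.Nonempty}, ⟨?_, eq_univ_of_forall fun y => ?_⟩, ?_, fun y => ?_⟩
  · rintro _ ⟨⟨i, rfl⟩, -⟩
    exact hopen i
  · obtain ⟨i, hi⟩ := hcov y
    exact ⟨G i, ⟨⟨i, rfl⟩, y, hi⟩, hi⟩
  · rintro _ ⟨⟨i, rfl⟩, y, hy⟩
    obtain ⟨U, hU, hyU⟩ := hleb y (mem_univ y)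
    exact ⟨U, hU, fun z hz => hyU (hdiam i z hz y hy)⟩
  · refine (encard_le_encard ?_).trans (encard_sep_range_le hr hG y)
    exact fun V hV => ⟨hV.1.1, hV.2⟩

theorem exists_card_eq_and_eq_pred {ι : Type*} [Finite ι] {A : ℕ → Finset ι} (hA : Monotone A) :
    ∃ j, (A j).card = j ∧ A (j - 1) = A j := by
  have := Fintype.ofFinite ι
  have hex : ∃ j, (A j).card ≤ j := ⟨Fintype.card ι, Finset.card_le_univ _⟩
  classical
  obtain ⟨j, hj, hmin⟩ : ∃ j, (A j).card ≤ j ∧ ∀ i < j, i < (A i).card :=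
    ⟨Nat.find hex, Nat.find_spec hex, fun i hi => not_le.1 (Nat.find_min hex hi)⟩
  rcases j with - | j
  · exact ⟨0, Nat.le_zero.1 hj, rfl⟩
  · have hsub : A j ⊆ A (j + 1) := hA j.le_succ
    have hlt := hmin j j.lt_succ_self
    have hle := Finset.card_le_card hsub
    exact ⟨j + 1, by lia, Finset.eq_of_subset_of_card_le hsub (by lia)⟩

theorem exists_finset_gap {ι : Type*} [Finite ι] (d : ι → ℝ) {θ : ℕ → ℝ} (hθ : StrictAnti θ) :
    ∃ S : Finset ι, (∀ i ∈ S, θ S.card < d i) ∧ ∀ i ∉ S, d i < θ S.card := by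
  classical
  have := Fintype.ofFinite ι
  let η : ℕ → ℝ := fun j => (θ j + θ (j + 1)) / 2
  have hη : StrictAnti η := fun i j h => by
    linarith [hθ h, hθ (Nat.succ_lt_succ h), show η i = (θ i + θ (i + 1)) / 2 from rfl,
      show η j = (θ j + θ (j + 1)) / 2 from rfl]
  let A : ℕ → Finset ι := fun j => {i | η j < d i}
  have hmem : ∀ {j i}, i ∈ A j ↔ η j < d i := by simp [A]
  obtain ⟨j, hcard, hpred⟩ := exists_card_eq_and_eq_pred (A := A) fun i j h k hk =>
    hmem.2 ((hη.antitone h).trans_lt (hmem.1 hk))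
  refine ⟨A j, fun i hi => ?_, fun i hi => ?_⟩ <;> rw [hcard]
  · obtain ⟨k, rfl⟩ : ∃ k, j = k + 1 :=
      Nat.exists_eq_succ_of_ne_zero fun hj => by simp_all
    have := hmem.1 (hpred ▸ hi)
    simp only [Nat.add_sub_cancel, η] at this
    linarith [hθ k.lt_succ_self]
  · have := not_lt.1 (mt hmem.2 hi)
    simp only [η] at this
    linarith [hθ j.lt_succ_self]

section FacePiece

variable {ι : Type*} {N : ℕ} {S S' : Finset ι} {z z' : ι → ℤ} {t t' : ι → I}

/-- The width of the neighborhoods of the grid faces with `s` directions. -/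
noncomputable def faceWidth (s : ℕ) : ℝ := 1 / (s + 3)

/-- The points of the cube, scaled by `N`, that are close to the open face with the directions
`S` and the least corner `z` of the integer grid, and far from its boundary. The pieces of the
faces of one dimension are pairwise disjoint because `faceWidth` depends on the dimension only. -/
def facePiece (N : ℕ) (S : Finset ι) (z : ι → ℤ) : Set (ι → I) :=
  {t | (∀ i ∈ S, N * (t i : ℝ) ∈ Ioo (z i + faceWidth S.card) (z i + 1 - faceWidth S.card)) ∧
    ∀ i ∉ S, N * (t i : ℝ) ∈ Ioo (z i - faceWidth S.card) (z i + faceWidth S.card)}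

theorem strictAnti_faceWidth : StrictAnti faceWidth := fun s s' h =>
  one_div_lt_one_div_of_lt (by positivity) (by gcongr)

theorem faceWidth_pos (s : ℕ) : 0 < faceWidth s := by
  unfold faceWidth
  positivity

theorem faceWidth_le (s : ℕ) : faceWidth s ≤ 1 / 3 := by
  refine (strictAnti_faceWidth.antitone s.zero_le).trans_eq ?_
  norm_num [faceWidth]

theorem isOpen_facePiece [Finite ι] (N : ℕ) (S : Finset ι) (z : ι → ℤ) :
    IsOpen (facePiece N S z) := by
  simp only [facePiece, ofPred_and, ofPred_forall]
  exact (isOpen_iInter_of_finite fun i => isOpen_iInter_of_finite fun _ =>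
      isOpen_Ioo.preimage (by fun_prop)).inter
    (isOpen_iInter_of_finite fun i => isOpen_iInter_of_finite fun _ =>
      isOpen_Ioo.preimage (by fun_prop))

theorem mem_Ioo_floor_of_lt_abs_sub_round {x θ : ℝ} (h : θ < |x - round x|) :
    x ∈ Ioo (⌊x⌋ + θ) (⌊x⌋ + 1 - θ) := by
  have hfloor := h.trans_le (round_le x ⌊x⌋)
  have hceil := h.trans_le (round_le x (⌊x⌋ + 1))
  push_cast at hceil
  rw [abs_of_nonneg (sub_nonneg.2 (Int.floor_le x))] at hfloor
  rw [abs_of_nonpos (by linarith [Int.lt_floor_add_one x])] at hceil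
  constructor <;> linarith

theorem exists_mem_facePiece [Finite ι] (N : ℕ) (t : ι → I) : ∃ S z, t ∈ facePiece N S z := by
  classical
  obtain ⟨S, hS, hSc⟩ := exists_finset_gap (fun i => |N * (t i : ℝ) - round (N * (t i : ℝ))|)
    strictAnti_faceWidth
  refine ⟨S, fun i => if i ∈ S then ⌊N * (t i : ℝ)⌋ else round (N * (t i : ℝ)), fun i hi => ?_,
    fun i hi => ?_⟩
  · simpa only [if_pos hi] using mem_Ioo_floor_of_lt_abs_sub_round (hS i hi)
  · obtain ⟨h, h'⟩ := abs_lt.1 (hSc i hi)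
    simp only [if_neg hi]
    constructor <;> linarith

theorem subset_of_mem_facePiece (h : t ∈ facePiece N S z) (h' : t ∈ facePiece N S' z')
    (hc : S.card = S'.card) : S ⊆ S' := by
  intro i hi
  by_contra hi'
  obtain ⟨h₁, h₂⟩ := h.1 i hi
  obtain ⟨h₃, h₄⟩ := h'.2 i hi'
  rw [← hc] at h₃ h₄
  have hlt : (z i : ℝ) < z' i := by linarith
  have hlt' : (z' i : ℝ) < z i + 1 := by linarith
  norm_cast at hlt hlt'
  lia

theorem eq_of_mem_facePiece (h : t ∈ facePiece N S z) (h' : t ∈ facePiece N S' z')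
    (hc : S.card = S'.card) : S = S' ∧ z = z' := by
  obtain rfl := Finset.eq_of_subset_of_card_le (subset_of_mem_facePiece h h' hc) hc.ge
  refine ⟨rfl, funext fun i => ?_⟩
  have hpos := faceWidth_pos S.card
  have hle := faceWidth_le S.card
  have key : (z i : ℝ) < z' i + 1 ∧ (z' i : ℝ) < z i + 1 := by
    by_cases hi : i ∈ S
    · obtain ⟨h₁, h₂⟩ := h.1 i hi
      obtain ⟨h₃, h₄⟩ := h'.1 i hi
      constructor <;> linarith
    · obtain ⟨h₁, h₂⟩ := h.2 i hi
      obtain ⟨h₃, h₄⟩ := h'.2 i hi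
      constructor <;> linarith
  norm_cast at key
  lia

theorem dist_le_of_mem_facePiece [Fintype ι] (hN : 0 < N) (h : t ∈ facePiece N S z)
    (h' : t' ∈ facePiece N S z) : dist t t' ≤ 1 / N := by
  have hN' : (0 : ℝ) < N := Nat.cast_pos.2 hN
  have hpos := faceWidth_pos S.card
  have hle := faceWidth_le S.card
  refine (dist_pi_le_iff (by positivity)).2 fun i => ?_
  rw [le_div_iff₀ hN', Subtype.dist_eq, Real.dist_eq, ← Nat.abs_cast N, ← abs_mul, mul_comm,
    mul_sub, abs_le]
  by_cases hi : i ∈ S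
  · obtain ⟨h₁, h₂⟩ := h.1 i hi
    obtain ⟨h₃, h₄⟩ := h'.1 i hi
    constructor <;> linarith
  · obtain ⟨h₁, h₂⟩ := h.2 i hi
    obtain ⟨h₃, h₄⟩ := h'.2 i hi
    constructor <;> linarith

end FacePiece

theorem exists_clopen_partition_dist_lt {T : Type*} [MetricSpace T] [CompactSpace T]
    [TotallyDisconnectedSpace T] {δ : ℝ} (hδ : 0 < δ) :
    ∃ (k : ℕ) (C : Fin k → Set T), (∀ j, IsOpen (C j)) ∧ (∀ x, ∃ j, x ∈ C j) ∧
      (∀ i j, (C i ∩ C j).Nonempty → i = j) ∧ ∀ j, ∀ x ∈ C j, ∀ y ∈ C j, dist x y < δ := by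
  have hcov : TopologicalSpace.IsOpenCover fun x : T =>
      (⟨Metric.ball x (δ / 2), Metric.isOpen_ball⟩ : TopologicalSpace.Opens T) :=
    .mk (eq_top_iff.2 fun x _ => TopologicalSpace.Opens.mem_iSup.2
      ⟨x, Metric.mem_ball_self (half_pos hδ)⟩)
  obtain ⟨k, C, hC, hCcov, hdisj⟩ := hcov.exists_finite_nonempty_disjoint_clopen_cover
  refine ⟨k, fun j => C j, fun j => (C j).isOpen, fun x => mem_iUnion.1 (hCcov (mem_univ x)),
    fun i j ⟨x, hi, hj⟩ => ?_, fun j x hx y hy => ?_⟩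
  · by_contra hij
    exact (TopologicalSpace.Clopens.coe_disjoint.2 (hdisj hij)).le_bot ⟨hi, hj⟩
  · obtain ⟨-, c, hc⟩ := hC j
    linarith [dist_triangle_right x y c, Metric.mem_ball.1 (hc hx), Metric.mem_ball.1 (hc hy)]

theorem dimLE_prod_cube {T : Type u} [TopologicalSpace T] [CompactSpace T]
    [TotallyDisconnectedSpace T] [TopologicalSpace.MetrizableSpace T] (m : ℕ) :
    DimLE m (T × (Fin m → I)) := by
  let _ := TopologicalSpace.metrizableSpaceMetric T
  refine dimLE_of_forall_exists_rank fun δ hδ => ?_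
  obtain ⟨N, hN⟩ := exists_nat_one_div_lt hδ
  rw [← Nat.cast_add_one] at hN
  obtain ⟨k, C, hCo, hCcov, hCeq, hCδ⟩ := exists_clopen_partition_dist_lt (T := T) hδ
  refine ⟨Fin k × Finset (Fin m) × (Fin m → ℤ), fun i => C i.1 ×ˢ facePiece (N + 1) i.2.1 i.2.2,
    fun i => i.2.1.card, fun i => (hCo i.1).prod (isOpen_facePiece _ _ _), fun b => ?_,
    fun i b hb b' hb' => ?_, fun i => card_finset_fin_le _, ?_⟩
  · obtain ⟨j, hj⟩ := hCcov b.1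
    obtain ⟨S, z, hSz⟩ := exists_mem_facePiece (N + 1) b.2
    exact ⟨(j, S, z), hj, hSz⟩
  · exact max_lt (hCδ i.1 b.1 hb.1 b'.1 hb'.1)
      ((dist_le_of_mem_facePiece N.succ_pos hb.2 hb'.2).trans_lt hN)
  · rintro ⟨j, S, z⟩ ⟨j', S', z'⟩ ⟨b, hb, hb'⟩ hcard
    obtain rfl := hCeq j j' ⟨b.1, hb.1, hb'.1⟩
    obtain ⟨rfl, rfl⟩ := eq_of_mem_facePiece hb.2 hb'.2 hcard
    rfl

/-! ### Local extension properties of absolute neighborhood extensors -/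

open Filter in
theorem continuousOn_onePoint_nat_elim {Z : Type*} {Y : Type v} [TopologicalSpace Z]
    [UniformSpace Y] {φ : ℕ → Z → Y} {y : Y} {D : Set Z} (hφ : ∀ i, ContinuousOn (φ i) D)
    (hlim : TendstoUniformlyOn φ (fun _ => y) atTop D) :
    ContinuousOn (fun b : OnePoint ℕ × Z => b.1.elim y fun i => φ i b.2)
      {b | b.1 = OnePoint.infty ∨ b.2 ∈ D} := by
  rintro ⟨τ, t⟩ hb
  induction τ using OnePoint.rec with
  | infty =>
    refine Uniform.tendsto_nhds_right.2 fun V hV => ?_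
    have hnear : ∀ᶠ τ in 𝓝 (OnePoint.infty : OnePoint ℕ),
        ∀ t ∈ D, (y, τ.elim y fun i => φ i t) ∈ V := by
      rw [OnePoint.nhds_infty_eq, coclosedCompact_eq_cocompact, cocompact_eq_cofinite,
        Nat.cofinite_eq_atTop, eventually_sup, eventually_map, eventually_pure]
      exact ⟨hlim V hV, fun _ _ => refl_mem_uniformity hV⟩
    rw [mem_map]
    filter_upwards [mem_nhdsWithin_of_mem_nhds (continuous_fst.tendsto _ hnear),
      self_mem_nhdsWithin]
    rintro ⟨_, t'⟩ h (rfl | ht)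
    · exact refl_mem_uniformity hV
    · exact h t' ht
  | coe i =>
    have hopen : IsOpen (Prod.fst ⁻¹' {(i : OnePoint ℕ)} : Set (OnePoint ℕ × Z)) := by
      refine IsOpen.preimage continuous_fst ?_
      rw [← image_singleton]
      exact OnePoint.isOpenEmbedding_coe.isOpenMap _ (isOpen_discrete _)
    rw [← continuousWithinAt_inter (hopen.mem_nhds rfl)]
    have hcont : ContinuousOn (fun b : OnePoint ℕ × Z => φ i b.2)
        ({b | b.1 = OnePoint.infty ∨ b.2 ∈ D} ∩ Prod.fst ⁻¹' {(i : OnePoint ℕ)}) := by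
      refine (hφ i).comp continuousOn_snd ?_
      rintro ⟨_, t'⟩ ⟨hb', rfl⟩
      exact hb'.resolve_left (OnePoint.coe_ne_infty i)
    refine hcont.congr ?_ _ ⟨hb, rfl⟩
    rintro ⟨_, t'⟩ ⟨-, rfl⟩
    rfl

namespace IsANE

variable {n : ℕ} {Y : Type v}

theorem exists_extension [TopologicalSpace Y] (hY : IsANE n Y) {B : Type} [TopologicalSpace B]
    [TopologicalSpace.MetrizableSpace B] (hB : DimLE n B) {A : Set B} (hA : IsClosed A) {ψ : B → Y}
    (hψ : ContinuousOn ψ A) :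
    ∃ O, IsOpen O ∧ A ⊆ O ∧ ∃ ψ' : B → Y, ContinuousOn ψ' O ∧ EqOn ψ' ψ A := by
  have : TopologicalSpace.MetrizableSpace (ULift.{v} B) :=
    Homeomorph.ulift.isEmbedding.metrizableSpace
  let _ : MetricSpace (ULift.{v} B) := TopologicalSpace.metrizableSpaceMetric _
  obtain ⟨O, hO, hAO, φ, hφ⟩ := hY (ULift.{v} B) (hB.of_homeomorph Homeomorph.ulift.symm)
    (ULift.down ⁻¹' A) (hA.preimage continuous_uliftDown)
    ⟨fun a => ψ a.1.down, hψ.comp_continuous (by fun_prop) fun a => a.2⟩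
  classical
  let ψ' : B → Y := fun b => if h : ULift.up b ∈ O then φ ⟨_, h⟩ else ψ b
  have hψ' : ∀ b (h : ULift.up b ∈ O), ψ' b = φ ⟨_, h⟩ := fun b h => dif_pos h
  refine ⟨ULift.up ⁻¹' O, hO.preimage continuous_uliftUp, fun b hb => hAO hb, ψ', ?_,
    fun b hb => (hψ' b (hAO hb)).trans (hφ ⟨_, hb⟩)⟩
  rw [continuousOn_iff_continuous_domRestrict]
  refine Continuous.congr ?_ fun b => (hψ' b.1 b.2).symm
  exact φ.continuous.comp
    ((continuous_uliftUp.comp continuous_subtype_val).subtype_mk fun b => b.2)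

open Filter in
theorem eventually_exists_extension [UniformSpace Y] (hY : IsANE n Y) {Z : Type}
    [TopologicalSpace Z] [TopologicalSpace.MetrizableSpace Z] [CompactSpace Z]
    (hZ : DimLE n (OnePoint ℕ × Z)) {D : Set Z} (hD : IsClosed D) {φ : ℕ → Z → Y} {y : Y}
    (hφ : ∀ i, ContinuousOn (φ i) D) (hlim : TendstoUniformlyOn φ (fun _ => y) atTop D)
    {U : Set Y} (hU : U ∈ 𝓝 y) :
    ∀ᶠ i in atTop, ∃ φ' : Z → Y, Continuous φ' ∧ EqOn (φ i) φ' D ∧ ∀ t, φ' t ∈ U := by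
  -- All the maps `φ i`, and the constant map at the limit, are extended at once.
  obtain ⟨O, hO, hAO, ψ, hψ, hψA⟩ := hY.exists_extension hZ
    ((isClosed_singleton.preimage continuous_fst).union (hD.preimage continuous_snd))
    (continuousOn_onePoint_nat_elim hφ hlim)
  have hψinf : ∀ t, (OnePoint.infty, t) ∈ O ∧ ψ (OnePoint.infty, t) = y := fun t =>
    ⟨hAO (Or.inl rfl), hψA (Or.inl rfl)⟩
  have hnear : ∀ᶠ τ in 𝓝 (OnePoint.infty : OnePoint ℕ), ∀ t ∈ (univ : Set Z),
      (τ, t) ∈ O ∧ ψ (τ, t) ∈ U := by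
    refine isCompact_univ.eventually_forall_of_forall_eventually fun t _ => ?_
    have hmem := hO.mem_nhds (hψinf t).1
    refine (show ∀ᶠ b in 𝓝 _, b ∈ O from hmem).and ((hψ.continuousAt hmem).eventually_mem ?_)
    rwa [(hψinf t).2]
  have hcoe : Tendsto ((↑) : ℕ → OnePoint ℕ) atTop (𝓝 OnePoint.infty) := by
    simpa using OnePoint.tendsto_coe_infty (X := ℕ)
  filter_upwards [hcoe.eventually hnear] with i hi
  exact ⟨fun t => ψ (i, t), hψ.comp_continuous (by fun_prop) fun t => (hi t (mem_univ t)).1,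
    fun t ht => (hψA (x := (↑i, t)) (Or.inr ht)).symm, fun t => (hi t (mem_univ t)).2⟩

theorem exists_cubeExtension [PseudoMetricSpace Y] (hY : IsANE n Y) {k : ℕ} (hk : k < n)
    {U : Set Y} {y : Y} (hU : U ∈ 𝓝 y) :
    ∃ ε > 0, CubeExtension (k + 1) (Metric.ball y ε) U := by
  by_contra! hno
  have hbad : ∀ i : ℕ, ∃ φ : (Fin (k + 1) → I) → Y, ContinuousOn φ (Cube.boundary _) ∧
      (∀ t ∈ Cube.boundary _, φ t ∈ Metric.ball y (1 / (i + 1))) ∧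
      ¬ ∃ φ', Continuous φ' ∧ EqOn φ φ' (Cube.boundary _) ∧ ∀ t, φ' t ∈ U := fun i => by
    simpa only [CubeExtension, not_forall, exists_prop] using
      hno (1 / (i + 1)) Nat.one_div_pos_of_nat
  choose φ hφ hφy hφU using hbad
  have hlim : TendstoUniformlyOn φ (fun _ => y) Filter.atTop (Cube.boundary _) := by
    refine Metric.tendstoUniformlyOn_iff.2 fun ε hε => ?_
    filter_upwards [tendsto_one_div_add_atTop_nhds_zero_nat.eventually_lt_const hε]
      with i hi t ht
    exact (Metric.mem_ball'.1 (hφy i t ht)).trans hi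
  obtain ⟨i, hi⟩ := (hY.eventually_exists_extension ((dimLE_prod_cube (k + 1)).mono hk)
    (isClosed_cubeBoundary _) hφ hlim hU).exists
  exact hφU i hi

theorem hasLocalExtensions [PseudoMetricSpace Y] (hY : IsANE n Y) :
    HasLocalExtensions n (id : Y → Y) := by
  intro 𝒰 h𝒰
  choose U hU hyU using h𝒰.exists_mem
  choose ε hε hext using fun (y : Y) (k : Fin n) =>
    hY.exists_cubeExtension k.2 ((h𝒰.1 _ (hU y)).mem_nhds (hyU y))
  let W : Y → Set Y := fun y => U y ∩ ⋂ k : Fin n, Metric.ball y (ε y k)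
  refine ⟨range W, isOpenCovering_range (fun y => (h𝒰.1 _ (hU y)).inter
    (isOpen_iInter_of_finite fun k => Metric.isOpen_ball)) fun y => ⟨y, hyU y, mem_iInter.2
      fun k => Metric.mem_ball_self (hε y k)⟩, ?_⟩
  rintro _ ⟨y, rfl⟩
  exact ⟨U y, hU y, inter_subset_left, fun k hk => (hext y ⟨k, hk⟩).mono
    (inter_subset_right.trans (iInter_subset _ _)) Subset.rfl⟩

end IsANE

end FineHomotopy

theorem lemmaL (n : ℕ) {X : Type u} {Y : Type v} [TopologicalSpace X] [MetricSpace Y]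
    (hdim : FineHomotopy.DimLE n Y) (hY : FineHomotopy.IsANE n Y)
    (f : C(X, Y)) (hf : FineHomotopy.IsUVMap n f) :
    FineHomotopy.IsFineNHomotopyEquiv.{u, v, w} n f := by
  intro 𝒰 h𝒰
  obtain ⟨𝒱, h𝒱, hX𝒱⟩ :=
    hf.hasLocalExtensions.exists_homotopicWithin.{u, v, w} f.continuous h𝒰
  obtain ⟨𝒲, h𝒲, hY𝒲⟩ := hY.hasLocalExtensions.exists_homotopicWithin.{v, v, w} continuous_id h𝒰
  obtain ⟨g, hg⟩ := FineHomotopy.exists_approximate_rightInverse hdim hf.hasLocalExtensions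
    hf.denseRange (h𝒱.inter h𝒲)
  refine ⟨g, fun V K hK Φ => ?_, fun V K hK Φ => ?_⟩
  · rw [← FineHomotopy.preimageFamily_id 𝒰]
    refine hY𝒲 V K hK _ _ fun p => ?_
    obtain ⟨U, hU, hgU, hpU⟩ := hg (Φ p)
    obtain ⟨W, hW, hUW⟩ := FineHomotopy.inter_refines_right 𝒱 𝒲 U hU
    exact ⟨W, hW, hUW hgU, hUW hpU⟩
  · refine hX𝒱 V K hK _ _ fun p => ?_
    obtain ⟨U, hU, hgU, hpU⟩ := hg (f (Φ p))
    obtain ⟨W, hW, hUW⟩ := FineHomotopy.inter_refines_left 𝒱 𝒲 U hU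
    exact ⟨W, hW, hUW hgU, hUW hpU⟩
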